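/- Let $p$ be a prime and let $F$ be a non-archimedean local field of residue characteristic $p$, with normalized valuation $\nu_F$. Let $D$ be a central division algebra over $F$ of dimension $d^2$ with $d>1$, let $\mathrm{Nrd}\colon D\to F$ be its reduced norm, and put $\nu_D=\frac1d\,\nu_F\circ\mathrm{Nrd}$ and $\mathcal O_D=\{x\in D:\nu_D(x)\ge 0\}$. Let $\varpi_D\in D$ be a uniformizer, i.e. $\nu_D(\varpi_D)=\frac1d$. For $i\ge1$ let $I_i=1+\varpi_D^i\mathcal O_D\subset D^\times$ and $I_{i,\mathrm{Nrd}=1}=\{x\in I_i:\mathrm{Nrd}(x)=1\}$. Let $I_1^p=\{x^p:x\in I_1\}$ be the set of $p$-th powers, and for $H=I_1$ or $H=I_{1,\mathrm{Nrd}=1}$ let $[H,H]$ denote the closed subgroup generated by the commutators $xyx^{-1}y^{-1}$, $x,y\in H$. Assume either * ($p$-adic case) $F$ has characteristic $0$ and $p>de+1$, where $e=\nu_F(p)$ is the ramification index of $F/\mathbb Q_p$; or * (function field case) $F$ has characteristic $p$ and $\gcd(p,d)=1$. Then the Frattini subgroup of $I_1$, i.e. the closed subgroup generated by all commutators and all $p$-th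 powers of elements of $I_1$, is $$[I_1,I_1]\,I_1^p \;=\; I_{1,\mathrm{Nrd}=1}\,I_1^p\cap I_2,$$ where the products are products of sets. Moreover $$[I_{1,\mathrm{Nrd}=1},I_{1,\mathrm{Nrd}=1}]=I_{2,\mathrm{Nrd}=1}$$ (including the case $d=2$). Furthermore $I_1^p=1+\varpi_D^{de+1}\mathcal O_D$ in the $p$-adic case, and $I_1^p=\{1+x^p : x\in\varpi_D\mathcal O_D\}$ in the function field case. -/

import Mathlib

open scoped Pointwise WithZero TensorProduct Matrix ValuativeRel

/-- The normalized (multiplicatively written) valuation of a non-archimedean local field `F`, with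
values in `ℤᵐ⁰`. In terms of the additive valuation `ν_F` with `ν_F(π_F) = 1`, the inequality
`localVal F x ≤ WithZero.exp (-n)` says `ν_F(x) ≥ n`, and the corresponding equality says
`ν_F(x) = n`. -/
noncomputable def localVal (F : Type*) [Field F] [ValuativeRel F] [TopologicalSpace F]
    [IsNonarchimedeanLocalField F] (x : F) : ℤᵐ⁰ :=
  IsNonarchimedeanLocalField.valueGroupWithZeroIsoInt F (ValuativeRel.valuation F x)

/-- The absolute ramification index `e = ν_F(p)` of a `p`-adic field `F`. -/
noncomputable def absRamificationIndex (F : Type*) [Field F] [ValuativeRel F] [TopologicalSpace F]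
    [IsNonarchimedeanLocalField F] (p : ℕ) : ℕ :=
  (-(WithZero.log (localVal F (p : F)))).toNat

/-- `c : F` is the reduced norm of `x : D`: for some isomorphism `φ` between the base change
of `D` to the algebraic closure of `F` and a matrix algebra, `c` is the determinant of
`φ (1 ⊗ x)`. (For a central simple algebra there is exactly one such `c`.) -/
def IsReducedNorm (F : Type*) {D : Type*} [Field F] [Ring D] [Algebra F D] (x : D) (c : F) : Prop :=
  ∃ (n : ℕ) (φ : AlgebraicClosure F ⊗[F] D ≃ₐ[AlgebraicClosure F]
      Matrix (Fin n) (Fin n) (AlgebraicClosure F)),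
    (φ (1 ⊗ₜ[F] x)).det = algebraMap F (AlgebraicClosure F) c

open Classical in
/-- The reduced norm `Nrd : D → F` of a central simple algebra. -/
noncomputable def reducedNorm (F : Type*) {D : Type*} [Field F] [Ring D] [Algebra F D] (x : D) : F :=
  if h : ∃ c : F, IsReducedNorm F x c then h.choose else 0

section DivisionAlgebra

variable (F : Type*) {D : Type*} [Field F] [ValuativeRel F] [TopologicalSpace F]
  [IsNonarchimedeanLocalField F] [DivisionRing D] [Algebra F D]

/-- The ring of integers `O_D`: the elements `x` with `ν_D(x) ≥ 0`, where
`ν_D = (1/d) ν_F ∘ Nrd`. -/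
def divisionIntegers : Set D := {x | localVal F (reducedNorm F x) ≤ 1}

/-- `ϖ` is a uniformizer of `D`: `ν_D(ϖ) = 1/d`, that is, `ν_F(Nrd ϖ) = 1`. -/
def IsDivisionUniformizer (ϖ : D) : Prop :=
  localVal F (reducedNorm F ϖ) = WithZero.exp (-1 : ℤ)

/-- The subset `1 + ϖ ^ i O_D` of `D`. -/
def onePlus (ϖ : D) (i : ℕ) : Set D :=
  {z | ∃ y ∈ divisionIntegers F, z = 1 + ϖ ^ i * y}

/-- `I_i = 1 + ϖ ^ i O_D`, as a set of units of `D`. -/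
def unitFiltration (ϖ : D) (i : ℕ) : Set Dˣ := {u | (u : D) ∈ onePlus F ϖ i}

/-- `I_{i, Nrd = 1}`: the elements of `I_i` of reduced norm one. -/
def unitFiltrationNormOne (ϖ : D) (i : ℕ) : Set Dˣ :=
  {u | u ∈ unitFiltration F ϖ i ∧ reducedNorm F (u : D) = 1}

end DivisionAlgebra

section Groups

variable {G : Type*} [Group G]

/-- The set of `p`-th powers of the elements of `S`. -/
def powerSet (p : ℕ) (S : Set G) : Set G := (fun g => g ^ p) '' S

/-- The set of commutators `x * y * x⁻¹ * y⁻¹` of elements of `S`. -/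
def commutators (S : Set G) : Set G := {g | ∃ x ∈ S, ∃ y ∈ S, x * y * x⁻¹ * y⁻¹ = g}

/-- The closed subgroup generated by the commutators of `S`. -/
def closedCommutator [TopologicalSpace G] (S : Set G) : Set G :=
  closure (Subgroup.closure (commutators S) : Set G)

/-- The closed subgroup generated by the commutators and the `p`-th powers of elements of `S`. -/
def closedFrattini [TopologicalSpace G] (p : ℕ) (S : Set G) : Set G :=
  closure (Subgroup.closure (commutators S ∪ powerSet p S) : Set G)

end Groups

/-! Both cases force `p` to be prime to `d`, so `d` is a unit in the residue fields, and this drives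
everything. Write `σ` for conjugation by `ϖ` on the residue field of `D`. It has order exactly `d`,
with fixed field the residue field of `F`. To see this, choose a Teichmüller generator `ζ` and a
uniformizer `τ` normalizing it (`exists_normalized_generators`): what commutes with both is central,
and central elements have valuation divisible by `d`.

The commutator formula is proved degree by degree (`exists_mem_C_inv_mul_mem`): for `n ≥ 2` a
norm-one element of `U n` agrees modulo `U (n + 1)` with a product of commutators of norm-one
elements. Commutators of `1 + α` and `1 + β` have leading term `α * β - β * α`, which `σ` makes
explicit. When `d ∤ n`, every leading term is reached, by two different constructions according to
whether `d ∣ n - 1`. When `d ∣ n`, additive Hilbert 90 splits the leading term into a `σ - 1` image,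
which is a commutator, and a central part, which norm one forces to vanish. Passing to the closure
gives one inclusion; the other holds because the norm-one condition is closed.

For the Frattini subgroup, reduced norms of its elements are `p`-th powers of principal units of
`F`, a compact set. Conversely, if `Nrd u = r ^ p`, write `r = s ^ d` by Hensel; then `u` is `s ^ p`
times a norm-one element, since `Nrd s = s ^ d`. In the `p`-adic case `p > d e + 1` gives `(x + y) ^
p ≡ x ^ p + p y`, so a Newton iteration extracts `p`-th roots; in characteristic `p` Frobenius is
additive on the commuting pair `1, x`.

These arguments use only the data in `ValuedDivisionAlgebra`. To supply them, the spectral norm of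
the minimal polynomial is compared with the determinant in a splitting: all eigenvalues of `y` are
conjugate, so `‖Nrd y‖` is the `n`-th power of the spectral value of `y`. -/

open ValuativeRel

/-! ### Local fields: valuation, norm, and roots of principal units -/

/-- A rank one structure on the canonical valuation of a local field. -/
@[reducible]
noncomputable def localRankOne (F : Type*) [Field F] [ValuativeRel F]
    [UniformSpace F] [IsUniformAddGroup F] [IsNonarchimedeanLocalField F] : (Valued.v (R := F)).RankOne :=
  { hom' := IsRankLeOne.nonempty.some.emb (R := F).comp MonoidWithZeroHom.ValueGroup₀.embedding
    strictMono' := IsRankLeOne.nonempty.some.strictMono.comp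
        MonoidWithZeroHom.ValueGroup₀.embedding_strictMono }

section LocalField

variable (F : Type*) [Field F] [ValuativeRel F] [TopologicalSpace F] [IsNonarchimedeanLocalField F]

/-- `localVal` as a bundled valuation. -/
noncomputable def localValuation : Valuation F ℤᵐ⁰ where
  toFun := localVal F
  map_zero' := by simp [localVal]
  map_one' := by simp [localVal]
  map_mul' x y := by simp [localVal]
  map_add_le_max' x y := by
    have hm := OrderHomClass.mono (IsNonarchimedeanLocalField.valueGroupWithZeroIsoInt F)
    exact le_max_iff.2 ((le_max_iff.1 ((valuation F).map_add x y)).imp (fun h => hm h)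
      fun h => hm h)

theorem localValuation_apply (x : F) : localValuation F x = localVal F x := rfl

theorem localValuation_surjective : Function.Surjective (localValuation F) := fun y => by
  obtain ⟨x, hx⟩ := valuation_surjective
    ((IsNonarchimedeanLocalField.valueGroupWithZeroIsoInt F).symm y)
  exact ⟨x, by simp [localValuation_apply, localVal, hx]⟩

theorem localValuation_le_iff (x y : F) :
    localValuation F x ≤ localValuation F y ↔ valuation F x ≤ valuation F y :=
  map_le_map_iff (IsNonarchimedeanLocalField.valueGroupWithZeroIsoInt F)

theorem localValuation_le_one_iff (x : F) :
    localValuation F x ≤ 1 ↔ valuation F x ≤ 1 := by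
  simpa using localValuation_le_iff F x 1

theorem localValuation_lt_one_iff (x : F) :
    localValuation F x < 1 ↔ valuation F x < 1 := by
  simpa using (localValuation_le_iff F 1 x).not

/-- A norm on a local field that defines its topology. -/
@[reducible]
noncomputable def localNormedField : NontriviallyNormedField F :=
  let := IsTopologicalAddGroup.rightUniformSpace F
  have := isUniformAddGroup_of_addCommGroup (G := F)
  let := localRankOne F
  Valued.toNontriviallyNormedField F (ValueGroupWithZero F)

theorem localNorm_le_iff (x y : F) :
    (localNormedField F).norm x ≤ (localNormedField F).norm y
      ↔ localValuation F x ≤ localValuation F y := by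
  rw [localValuation_le_iff]
  let := IsTopologicalAddGroup.rightUniformSpace F
  have := isUniformAddGroup_of_addCommGroup (G := F)
  let := localRankOne F
  exact Valued.toNormedField.norm_le_iff

theorem localNorm_ultrametric : let := localNormedField F; IsUltrametricDist F := by
  let := IsTopologicalAddGroup.rightUniformSpace F
  have := isUniformAddGroup_of_addCommGroup (G := F)
  let := localRankOne F
  open scoped Valued in
  infer_instance

theorem localNorm_completeSpace : let := localNormedField F; CompleteSpace F := by
  let := IsTopologicalAddGroup.rightUniformSpace F
  have := isUniformAddGroup_of_addCommGroup (G := F)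
  let := localRankOne F
  exact inferInstanceAs (CompleteSpace F)

theorem localNorm_properSpace : let := localNormedField F; ProperSpace F := by
  let := localNormedField F
  have : LocallyCompactSpace F := ‹IsNonarchimedeanLocalField F›.toLocallyCompactSpace
  exact .of_nontriviallyNormedField_of_weaklyLocallyCompactSpace F

theorem integer_mem_maximalIdeal_iff (x : 𝒪[F]) :
    x ∈ 𝓂[F] ↔ localValuation F (x : F) < 1 := by
  rw [localValuation_lt_one_iff, IsLocalRing.mem_maximalIdeal, mem_nonunits_iff,
    Valuation.Integer.not_isUnit_iff_valuation_lt_one]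

theorem localValuation_natCast_lt_one_iff (p : ℕ) [CharP 𝓀[F] p] (n : ℕ) :
    localValuation F (n : F) < 1 ↔ p ∣ n := by
  have h := integer_mem_maximalIdeal_iff F (n : 𝒪[F])
  rw [← IsLocalRing.residue_eq_zero_iff, map_natCast, CharP.cast_eq_zero_iff 𝓀[F] p] at h
  simpa using h.symm

theorem localValuation_natCast_le_one (n : ℕ) : localValuation F (n : F) ≤ 1 := by
  rw [localValuation_le_one_iff]
  exact_mod_cast (n : 𝒪[F]).2

theorem localValuation_natCast_eq_one (p : ℕ) [CharP 𝓀[F] p] (n : ℕ) (h : ¬ p ∣ n) :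
    localValuation F (n : F) = 1 :=
  (localValuation_natCast_le_one F n).antisymm
    (not_lt.1 fun h' => h ((localValuation_natCast_lt_one_iff F p n).1 h'))

open Polynomial in
/-- Hensel's lemma for `T ^ d - u`, when `d` is invertible in the residue field. -/
theorem exists_pow_eq_of_localValuation_sub_one_lt {d : ℕ} (hd : localValuation F (d : F) = 1)
    {u : F} (hu : localValuation F (u - 1) < 1) :
    ∃ r : F, r ^ d = u ∧ localValuation F (r - 1) < 1 := by
  let := IsTopologicalAddGroup.rightUniformSpace F
  have := isUniformAddGroup_of_addCommGroup (G := F)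
  have hd0 : d ≠ 0 := by rintro rfl; simp at hd
  have hu1 : u ∈ 𝒪[F] := by
    change valuation F u ≤ 1
    rw [← localValuation_le_one_iff, ← sub_add_cancel u 1]
    exact (Valuation.map_add _ _ _).trans (max_le hu.le (by simp))
  -- Hensel starts at `1`: the value there is `1 - u`, in the maximal ideal, and the derivative is
  -- the unit `d`.
  obtain ⟨r, hr, hr1⟩ := HenselianRing.is_henselian (I := 𝓂[F])
    (X ^ d - C (⟨u, hu1⟩ : 𝒪[F])) (monic_X_pow_sub_C _ hd0) 1
    (by
      rw [integer_mem_maximalIdeal_iff]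
      have h : ((eval 1 (X ^ d - C (⟨u, hu1⟩ : 𝒪[F])) : 𝒪[F]) : F) = 1 - u := by
        simp
      rwa [h, Valuation.map_sub_swap])
    (by
      refine IsUnit.map _ ?_
      by_contra h
      have h' := (integer_mem_maximalIdeal_iff F _).1 ((IsLocalRing.mem_maximalIdeal _).2 h)
      have h2 : ((eval 1 (derivative (X ^ d - C (⟨u, hu1⟩ : 𝒪[F]))) : 𝒪[F]) : F) = d := by
        simp [derivative_X_pow]
      rw [h2, hd] at h'
      exact lt_irrefl _ h')
  rw [integer_mem_maximalIdeal_iff] at hr1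
  refine ⟨r, ?_, by simpa using hr1⟩
  have h := congrArg (Subtype.val) hr
  simpa [sub_eq_zero] using h

end LocalField

/-- In a valued field, `r ↦ r ^ d` preserves the distance of a principal unit to `1` when `d` is
a unit. -/
theorem Valuation.map_pow_sub_one_of_lt {K Γ : Type*} [CommRing K]
    [LinearOrderedCommGroupWithZero Γ] (w : Valuation K Γ) {d : ℕ} (hd : w (d : K) = 1)
    {r : K} (hr : w (r - 1) < 1) : w (r ^ d - 1) = w (r - 1) := by
  -- The geometric sum is congruent to its number of terms, because every power of `r` is congruent
  -- to `1`; with `d` terms it is a unit.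
  have key : ∀ n : ℕ, w (∑ i ∈ Finset.range n, r ^ i - n) < 1 := by
    have hpow : ∀ i : ℕ, w (r ^ i - 1) < 1 := by
      intro i
      induction i with
      | zero => simp
      | succ i ih =>
        have h1 : w r ≤ 1 := by
          rw [← sub_add_cancel r 1]
          exact (w.map_add _ _).trans (max_le hr.le (by simp))
        have : r ^ (i + 1) - 1 = r * (r ^ i - 1) + (r - 1) := by ring
        rw [this]
        refine w.map_add_lt ?_ hr
        rw [map_mul]
        exact (mul_le_of_le_one_left' h1).trans_lt ih
    intro n
    induction n with
    | zero => simp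
    | succ n ih =>
      rw [Finset.sum_range_succ, Nat.cast_succ]
      have : ∑ i ∈ Finset.range n, r ^ i + r ^ n - ((n : K) + 1)
        = (∑ i ∈ Finset.range n, r ^ i - n) + (r ^ n - 1) := by ring
      rw [this]
      exact w.map_add_lt ih (hpow n)
  have h1 : w (∑ i ∈ Finset.range d, r ^ i) = 1 := by
    rw [← hd]
    exact w.map_eq_of_sub_lt (by rw [hd]; exact key d)
  rw [← geom_sum_mul, map_mul, h1, one_mul]

section LocalField

variable (F : Type*) [Field F] [ValuativeRel F] [TopologicalSpace F] [IsNonarchimedeanLocalField F]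

/-- The `p`-th powers of principal units form a closed set. -/
theorem exists_pow_eq_of_approx (p : ℕ) (u : F)
    (h : ∀ m : ℕ, ∃ r : F, localValuation F (r - 1) < 1 ∧
      localValuation F (u - r ^ p) ≤ WithZero.exp (-(m : ℤ))) :
    ∃ r : F, localValuation F (r - 1) < 1 ∧ u = r ^ p := by
  obtain ⟨ϖ, hϖ⟩ := localValuation_surjective F (WithZero.exp (-1))
  -- Discreteness turns the open unit ball into a closed ball, which is compact; so is its image
  -- under `x ↦ (x + 1) ^ p`.
  have hlt : ∀ x : F, localValuation F x < 1 ↔ valuation F x ≤ valuation F ϖ := by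
    intro x
    rw [← localValuation_le_iff, hϖ]
    by_cases hx : localValuation F x = 0
    · simp [hx]
    · rw [← WithZero.exp_log hx, ← WithZero.exp_zero, WithZero.exp_lt_exp, WithZero.exp_le_exp]
      omega
  have hc : IsCompact ((fun x : F => (x + 1) ^ p) '' {x | valuation F x ≤ valuation F ϖ}) :=
    (IsNonarchimedeanLocalField.isCompact_closedBall F _).image (by fun_prop)
  have hT2 : T2Space F := by
    let := localNormedField F
    exact inferInstanceAs (T2Space F)
  have hu : u ∈ closure ((fun x : F => (x + 1) ^ p) '' {x | valuation F x ≤ valuation F ϖ}) := by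
    rw [mem_closure_iff_nhds]
    intro t ht
    rw [IsValuativeTopology.mem_nhds_iff'] at ht
    obtain ⟨γ, hγ⟩ := ht
    obtain ⟨z, hz⟩ := valuation_surjective (γ : ValueGroupWithZero F)
    have hz0 : localValuation F z ≠ 0 := by
      rw [Valuation.ne_zero_iff]
      rintro rfl
      exact γ.ne_zero (by rw [← hz, map_zero])
    obtain ⟨n, hn⟩ := WithZero.exists_exp_neg_natCast_lt hz0
    obtain ⟨r, hr, hr'⟩ := h n
    refine ⟨r ^ p, hγ ?_, r - 1, (hlt _).1 hr, by simp⟩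
    have h1 : localValuation F (r ^ p - u) < localValuation F z := by
      rw [Valuation.map_sub_swap]; exact hr'.trans_lt hn
    rw [← not_le, localValuation_le_iff, not_le, hz] at h1
    exact h1
  rw [hc.isClosed.closure_eq] at hu
  obtain ⟨x, hx, rfl⟩ := hu
  exact ⟨x + 1, by rw [add_sub_cancel_right]; exact (hlt _).2 hx, rfl⟩

end LocalField

/-! ### Reduced norm: descent of the determinant to the base field -/

section ReducedNorm

open Polynomial

/-- Algebra automorphisms of a matrix algebra over a field preserve determinants. -/
theorem AlgEquiv.det_matrix_eq {K : Type*} [Field K] {n : ℕ}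
    (f : Matrix (Fin n) (Fin n) K ≃ₐ[K] Matrix (Fin n) (Fin n) K) (A : Matrix (Fin n) (Fin n) K) :
    (f A).det = A.det := by
  let e : Matrix (Fin n) (Fin n) K ≃ₐ[K] Module.End K (Fin n → K) := Matrix.toLinAlgEquiv'
  obtain ⟨T, hT⟩ := ((e.symm.trans f).trans e).eq_linearEquivConjAlgEquiv
  have h : e (f A) = T.conjAlgEquiv K (e A) := by
    rw [← hT]; simp
  have h1 : ∀ B, LinearMap.det (e B) = B.det := fun B => LinearMap.det_toLin' B
  rw [← h1, ← h1, h]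
  exact LinearMap.det_conj (e A) T

variable {F : Type*} {D : Type*} [Field F] [DivisionRing D] [Algebra F D]

/-- `D` is a vector space over the subfield generated by `y`, so the tower law applies. -/
theorem minpoly_natDegree_dvd_finrank [FiniteDimensional F D] (y : D) :
    (minpoly F y).natDegree ∣ Module.finrank F D := by
  have hy : IsIntegral F y := Algebra.IsIntegral.isIntegral y
  have : Fact (Irreducible (minpoly F y)) := ⟨minpoly.irreducible hy⟩
  let f : AdjoinRoot (minpoly F y) →ₐ[F] D := 
    Ideal.Quotient.liftₐ (Ideal.span {minpoly F y}) (aeval y) fun a ha => by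
      obtain ⟨b, rfl⟩ := Ideal.mem_span_singleton'.1 ha
      rw [map_mul, minpoly.aeval, mul_zero]
  let : Module (AdjoinRoot (minpoly F y)) D := Module.compHom D f.toRingHom
  have : IsScalarTower F (AdjoinRoot (minpoly F y)) D := ⟨fun a b x => by
    change f (a • b) * x = a • (f b * x)
    rw [map_smul, smul_mul_assoc]⟩
  have h := Module.finrank_mul_finrank F (AdjoinRoot (minpoly F y)) D
  rw [(AdjoinRoot.powerBasis (minpoly.ne_zero hy)).finrank, AdjoinRoot.powerBasis_dim] at h
  exact ⟨_, h.symm⟩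

/-- An inseparable irreducible polynomial is a polynomial in `X ^ p`, so its degree is a multiple of
`p`, and that degree divides the dimension. -/
theorem minpoly_separable_of_not_dvd_finrank [FiniteDimensional F D]
    (h : CharZero F ∨ ∃ p : ℕ, CharP F p ∧ ¬ p ∣ Module.finrank F D) (y : D) :
    (minpoly F y).Separable := by
  have hi : Irreducible (minpoly F y) := minpoly.irreducible (Algebra.IsIntegral.isIntegral y)
  rcases h with h | ⟨p, hp, hpd⟩
  · exact hi.separable
  · refine (separable_or p hi).resolve_right fun ⟨_, g, _, hg⟩ => hpd ?_
    refine dvd_trans ?_ (minpoly_natDegree_dvd_finrank (F := F) y)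
    rw [← hg, natDegree_expand]
    exact dvd_mul_left _ _

variable {n : ℕ} (φ : AlgebraicClosure F ⊗[F] D ≃ₐ[AlgebraicClosure F]
  Matrix (Fin n) (Fin n) (AlgebraicClosure F))

/-- The matrix representation of `D` attached to a splitting. -/
noncomputable def splittingHom : D →ₐ[F] Matrix (Fin n) (Fin n) (AlgebraicClosure F) :=
  (φ.toAlgHom.restrictScalars F).comp Algebra.TensorProduct.includeRight

theorem splittingHom_apply (y : D) : splittingHom φ y = φ (1 ⊗ₜ[F] y) := rfl

include φ in
theorem sq_eq_finrank_of_splitting : n ^ 2 = Module.finrank F D := by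
  have h := φ.toLinearEquiv.finrank_eq
  rw [Module.finrank_baseChange, Module.finrank_matrix] at h
  simp only [Fintype.card_fin, Module.finrank_self, mul_one] at h
  rw [h, sq]

/-- Two splittings have the same size by dimension, and differ by a matrix automorphism, which is
inner. -/
theorem det_eq_det_of_splitting {m : ℕ} (ψ : AlgebraicClosure F ⊗[F] D ≃ₐ[AlgebraicClosure F]
    Matrix (Fin m) (Fin m) (AlgebraicClosure F)) (x : AlgebraicClosure F ⊗[F] D) :
    (ψ x).det = (φ x).det := by
  have hmn : m = n := by
    have := (sq_eq_finrank_of_splitting φ).trans (sq_eq_finrank_of_splitting ψ).symm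
    exact (Nat.pow_left_injective two_ne_zero this).symm
  subst hmn
  simpa using AlgEquiv.det_matrix_eq (φ.symm.trans ψ) (φ x)

/-- The Galois conjugate of a splitting. -/
noncomputable def galoisSplitting (σ : AlgebraicClosure F ≃ₐ[F] AlgebraicClosure F) :
    AlgebraicClosure F ⊗[F] D ≃ₐ[AlgebraicClosure F]
      Matrix (Fin n) (Fin n) (AlgebraicClosure F) :=
  AlgEquiv.ofRingEquiv
    (f := ((Algebra.TensorProduct.congr σ.symm (AlgEquiv.refl (R := F) (A₁ := D))).toRingEquiv.trans
      φ.toRingEquiv).trans σ.mapMatrix.toRingEquiv) (fun r => by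
      have h : φ (σ.symm r ⊗ₜ[F] 1) = algebraMap _ _ (σ.symm r) := φ.commutes (σ.symm r)
      have h' : (φ (σ.symm r ⊗ₜ[F] 1)).map σ = algebraMap _ _ r := by
        rw [h, Matrix.algebraMap_eq_diagonal, Matrix.diagonal_map (map_zero σ),
          Matrix.algebraMap_eq_diagonal]
        congr 1
        ext i
        simp
      simpa [Algebra.TensorProduct.algebraMap_apply] using h')

theorem galoisSplitting_apply (σ : AlgebraicClosure F ≃ₐ[F] AlgebraicClosure F) (y : D) :
    galoisSplitting φ σ (1 ⊗ₜ[F] y) = σ.mapMatrix (φ (1 ⊗ₜ[F] y)) := by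
  simp [galoisSplitting]

/-- An eigenvalue of `y` is a root of the minimal polynomial of `y`, which is irreducible as `D` has
no zero divisors. -/
theorem minpoly_eq_of_mem_roots_charpoly [FiniteDimensional F D] (y : D) {α : AlgebraicClosure F}
    (h : α ∈ (splittingHom φ y).charpoly.roots) : minpoly F α = minpoly F y := by
  have hy : IsIntegral F y := Algebra.IsIntegral.isIntegral y
  have h1 : α ∈ spectrum (AlgebraicClosure F) (splittingHom φ y) :=
    Matrix.mem_spectrum_iff_isRoot_charpoly.2 (isRoot_of_mem_roots h)
  have h2 := spectrum.subset_polynomial_aeval (splittingHom φ y)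
    ((minpoly F y).map (algebraMap F (AlgebraicClosure F))) ⟨α, h1, rfl⟩
  have h3 : aeval (splittingHom φ y) ((minpoly F y).map (algebraMap F (AlgebraicClosure F))) = 0 := by
    rw [aeval_map_algebraMap, aeval_algHom_apply, minpoly.aeval, map_zero]
  have : Nonempty (Fin n) := by
    by_contra hn
    have : IsEmpty (Fin n) := not_nonempty_iff.1 hn
    simp [Matrix.charpoly] at h
  have : Nontrivial (Matrix (Fin n) (Fin n) (AlgebraicClosure F)) := inferInstance
  rw [h3, spectrum.zero_eq, Set.mem_singleton_iff] at h2
  simp only [eval_map_algebraMap] at h2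
  exact (minpoly.eq_of_irreducible_of_monic (minpoly.irreducible hy) h2 (minpoly.monic hy)).symm

/-- The determinant of a splitting takes values in the base field, if the dimension is prime to
the characteristic. -/
theorem exists_isReducedNorm [FiniteDimensional F D]
    (h : CharZero F ∨ ∃ p : ℕ, CharP F p ∧ ¬ p ∣ Module.finrank F D) (y : D) :
    ∃ c : F, algebraMap F (AlgebraicClosure F) c = (φ (1 ⊗ₜ[F] y)).det := by
  rw [← splittingHom_apply]
  set δ := (splittingHom φ y).det with hδ
  -- The determinant is a product of eigenvalues, each separable because it shares its minimal
  -- polynomial with `y`.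
  have hsep : IsSeparable F δ := by
    rw [← mem_separableClosure_iff, hδ, Matrix.det_eq_prod_roots_charpoly]
    refine multiset_prod_mem _ fun α hα => ?_
    rw [mem_separableClosure_iff, IsSeparable, minpoly_eq_of_mem_roots_charpoly φ y hα]
    exact minpoly_separable_of_not_dvd_finrank h y
  -- A separable element outside `F` is moved by some `σ`. But `σ` of the determinant is the
  -- determinant in the conjugate splitting, and all splittings give the same determinant.
  have hbot : δ ∈ (⊥ : Subalgebra F (AlgebraicClosure F)) := by
    by_contra hn
    rw [notMem_iff_exists_ne_and_isConjRoot hsep (IsAlgClosed.splits _)] at hn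
    obtain ⟨z, hz, hc⟩ := hn
    obtain ⟨σ, hσ⟩ := isConjRoot_iff_exists_algEquiv.1 hc.symm
    apply hz
    rw [← hσ, hδ, splittingHom_apply, AlgEquiv.map_det, ← galoisSplitting_apply]
    exact (det_eq_det_of_splitting φ (galoisSplitting φ σ) _).symm
  exact hbot

theorem algebraMap_reducedNorm [FiniteDimensional F D]
    (h : CharZero F ∨ ∃ p : ℕ, CharP F p ∧ ¬ p ∣ Module.finrank F D) (y : D) :
    algebraMap F (AlgebraicClosure F) (reducedNorm F y) = (splittingHom φ y).det := by
  obtain ⟨c, hc⟩ := exists_isReducedNorm φ h y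
  have hex : ∃ c : F, IsReducedNorm F y c := ⟨c, n, φ, hc.symm⟩
  rw [reducedNorm, dif_pos hex]
  obtain ⟨m, ψ, hψ⟩ := hex.choose_spec
  rw [← hψ, splittingHom_apply, det_eq_det_of_splitting φ ψ]

include φ in
theorem ne_zero_of_splitting [FiniteDimensional F D] : n ≠ 0 := by
  rintro rfl
  have h := sq_eq_finrank_of_splitting φ
  have := Module.finrank_pos (R := F) (M := D)
  simp at h
  omega

section

variable [FiniteDimensional F D]
  (h : CharZero F ∨ ∃ p : ℕ, CharP F p ∧ ¬ p ∣ Module.finrank F D)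

include φ h

theorem reducedNorm_mul (x y : D) :
    reducedNorm F (x * y) = reducedNorm F x * reducedNorm F y := by
  apply (algebraMap F (AlgebraicClosure F)).injective
  rw [map_mul, algebraMap_reducedNorm φ h, algebraMap_reducedNorm φ h, algebraMap_reducedNorm φ h,
    map_mul, Matrix.det_mul]

theorem reducedNorm_algebraMap (a : F) : reducedNorm F (algebraMap F D a) = a ^ n := by
  apply (algebraMap F (AlgebraicClosure F)).injective
  rw [algebraMap_reducedNorm φ h, AlgHom.commutes, map_pow,
    IsScalarTower.algebraMap_apply F (AlgebraicClosure F) (Matrix (Fin n) (Fin n) _),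
    Matrix.algebraMap_eq_diagonal, Matrix.det_diagonal]
  simp

end

/-- `reducedNorm` defaults to `0` when no splitting exists, so a uniformizer alone already provides
one. -/
theorem exists_splitting_of_reducedNorm_ne_zero {y : D} (h : reducedNorm F y ≠ 0) :
    ∃ n : ℕ, Nonempty (AlgebraicClosure F ⊗[F] D ≃ₐ[AlgebraicClosure F]
      Matrix (Fin n) (Fin n) (AlgebraicClosure F)) := by
  by_cases hex : ∃ c : F, IsReducedNorm F y c
  · obtain ⟨c, n, φ, _⟩ := hex
    exact ⟨n, ⟨φ⟩⟩
  · rw [reducedNorm, dif_neg hex] at h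
    exact absurd rfl h

end ReducedNorm

/-! ### The spectral value as a multiplicative ultrametric norm on `D` -/

section SpectralNorm

open Polynomial

theorem MulAlgebraNorm.map_prod_one_sub_sub_one_le {K L : Type*} [NormedField K] [Field L]
    [Algebra K L] (f : MulAlgebraNorm K L) (hf : IsNonarchimedean f) {c : ℝ} (hc0 : 0 ≤ c)
    (hc : c ≤ 1) (s : Multiset L) (hs : ∀ α ∈ s, f α ≤ c) :
    f ((s.map fun α => 1 - α).prod - 1) ≤ c := by
  induction s using Multiset.induction_on with
  | empty => simpa using hc0
  | cons a s ih =>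
    have ih := ih fun α hα => hs α (Multiset.mem_cons_of_mem hα)
    have ha := hs a (Multiset.mem_cons_self a s)
    rw [Multiset.map_cons, Multiset.prod_cons]
    set P := (s.map fun α => 1 - α).prod
    have h1 : (1 - a) * P - 1 = (P - 1) + -(a * ((P - 1) + 1)) := by ring
    have h2 : f ((P - 1) + 1) ≤ 1 :=
      (hf _ _).trans (max_le (ih.trans hc) (by rw [map_one]))
    rw [h1]
    refine (hf _ _).trans (max_le ih ?_)
    rw [map_neg_eq_map, map_mul]
    exact (mul_le_of_le_one_right (apply_nonneg f a) h2).trans ha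

variable {F : Type*} {D : Type*} [NontriviallyNormedField F] [IsUltrametricDist F] [CompleteSpace F]
  [DivisionRing D] [Algebra F D] [FiniteDimensional F D]
variable {n : ℕ} (φ : AlgebraicClosure F ⊗[F] D ≃ₐ[AlgebraicClosure F]
  Matrix (Fin n) (Fin n) (AlgebraicClosure F))

theorem spectralNorm_of_mem_roots_charpoly {y : D} {α : AlgebraicClosure F}
    (h : α ∈ (splittingHom φ y).charpoly.roots) :
    spectralMulAlgNorm F (AlgebraicClosure F) α = spectralValue (minpoly F y) := by
  rw [spectralMulAlgNorm_def, spectralNorm, minpoly_eq_of_mem_roots_charpoly φ y h]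

/-- The determinant is a product of `n` mutually conjugate eigenvalues, all of the same spectral
norm. -/
theorem spectralNorm_det_splittingHom (y : D) :
    spectralMulAlgNorm F (AlgebraicClosure F) (splittingHom φ y).det
      = spectralValue (minpoly F y) ^ n := by
  rw [Matrix.det_eq_prod_roots_charpoly, map_multiset_prod,
    Multiset.map_congr rfl fun α hα => spectralNorm_of_mem_roots_charpoly φ hα, Multiset.map_const',
    Multiset.prod_replicate, ← (IsAlgClosed.splits _).natDegree_eq_card_roots,
    Matrix.charpoly_natDegree_eq_dim, Fintype.card_fin]

include φ in
theorem spectralValue_minpoly_neg (y : D) :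
    spectralValue (minpoly F (-y)) = spectralValue (minpoly F y) := by
  refine (pow_left_inj₀ (spectralValue_nonneg _) (spectralValue_nonneg _)
    (ne_zero_of_splitting φ)).1 ?_
  rw [← spectralNorm_det_splittingHom φ, ← spectralNorm_det_splittingHom φ, map_neg, Matrix.det_neg,
    map_mul, map_pow, map_neg_eq_map, map_one, one_pow, one_mul]

/-- `det (1 + y)` is the characteristic polynomial of `-y` at `1`, a product of factors `1 - α` each
close to `1`. -/
theorem spectralNorm_det_one_add_sub_one_le (y : D) (hy : spectralValue (minpoly F y) ≤ 1) :
    spectralMulAlgNorm F (AlgebraicClosure F) ((splittingHom φ (1 + y)).det - 1)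
      ≤ spectralValue (minpoly F y) := by
  have h : (splittingHom φ (1 + y)).det =
      ((splittingHom φ (-y)).charpoly.roots.map fun α => 1 - α).prod := by
    have h1 := Matrix.eval_charpoly (splittingHom φ (-y)) 1
    rw [map_one, map_neg, sub_neg_eq_add, ← map_one (splittingHom φ), ← map_add, ← map_neg] at h1
    rw [← h1, (IsAlgClosed.splits _).eval_eq_prod_roots_of_monic (Matrix.charpoly_monic _)]
  rw [h]
  refine MulAlgebraNorm.map_prod_one_sub_sub_one_le _ isNonarchimedean_spectralNorm
    (spectralValue_nonneg _) hy _ fun α hα => ?_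
  rw [spectralNorm_of_mem_roots_charpoly φ hα, spectralValue_minpoly_neg φ]

variable (h : CharZero F ∨ ∃ p : ℕ, CharP F p ∧ ¬ p ∣ Module.finrank F D)

include φ h

theorem norm_reducedNorm (y : D) : ‖reducedNorm F y‖ = spectralValue (minpoly F y) ^ n := by
  rw [← spectralNorm_det_splittingHom φ, ← algebraMap_reducedNorm φ h, spectralMulAlgNorm_def,
    spectralNorm_extends]

theorem norm_reducedNorm_one_add_sub_one_le (y : D) (hy : spectralValue (minpoly F y) ≤ 1) :
    ‖reducedNorm F (1 + y) - 1‖ ≤ spectralValue (minpoly F y) := by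
  have := spectralNorm_det_one_add_sub_one_le φ y hy
  rwa [← algebraMap_reducedNorm φ h, ← map_one (algebraMap F (AlgebraicClosure F)), ← map_sub,
    spectralMulAlgNorm_def, spectralNorm_extends] at this

/-- This is the `n`-th root of the multiplicativity of the reduced norm. -/
theorem spectralValue_minpoly_mul (x y : D) : spectralValue (minpoly F (x * y)) =
    spectralValue (minpoly F x) * spectralValue (minpoly F y) := by
  refine (pow_left_inj₀ (spectralValue_nonneg _)
    (mul_nonneg (spectralValue_nonneg _) (spectralValue_nonneg _)) (ne_zero_of_splitting φ)).1 ?_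
  simp only [mul_pow, ← norm_reducedNorm φ h, reducedNorm_mul φ h, norm_mul]

omit h φ [IsUltrametricDist F] [CompleteSpace F] in
theorem spectralValue_minpoly_eq_zero {x : D} : spectralValue (minpoly F x) = 0 ↔ x = 0 := by
  constructor
  · intro hx
    rw [spectralValue_eq_zero_iff (minpoly.monic (Algebra.IsIntegral.isIntegral x))] at hx
    have := minpoly.aeval F x
    rw [hx, map_pow, aeval_X] at this
    exact eq_zero_of_pow_eq_zero this
  · rintro rfl
    rw [minpoly.zero]
    simpa using spectralValue_X_pow (R := F) 1

omit h φ [IsUltrametricDist F] [CompleteSpace F] in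
theorem spectralValue_minpoly_algebraMap (a : F) :
    spectralValue (minpoly F (algebraMap F D a)) = ‖a‖ := by
  rw [minpoly.eq_X_sub_C, spectralValue_X_sub_C]

/-- Factoring out the larger summand reduces to `1 + z` with `z` integral, whose reduced norm is
integral because it differs from `1` by an integral element. -/
theorem spectralValue_minpoly_add_le (x y : D) : spectralValue (minpoly F (x + y)) ≤
    max (spectralValue (minpoly F x)) (spectralValue (minpoly F y)) := by
  have h1 : ∀ z : D, spectralValue (minpoly F z) ≤ 1 → spectralValue (minpoly F (1 + z)) ≤ 1 := by
    intro z hz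
    have h2 := norm_reducedNorm_one_add_sub_one_le φ h z hz
    have h3 : ‖reducedNorm F (1 + z)‖ ≤ 1 := by
      rw [← sub_add_cancel (reducedNorm F (1 + z)) 1]
      exact (IsUltrametricDist.norm_add_le_max _ _).trans (max_le (h2.trans hz) (by simp))
    rw [norm_reducedNorm φ h] at h3
    exact (pow_le_one_iff_of_nonneg (spectralValue_nonneg _) (ne_zero_of_splitting φ)).1 h3
  have h2 : ∀ x y : D, spectralValue (minpoly F y) ≤ spectralValue (minpoly F x) →
      spectralValue (minpoly F (x + y)) ≤ spectralValue (minpoly F x) := by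
    intro x y hxy
    rcases eq_or_ne x 0 with rfl | hx
    · rw [zero_add]; exact hxy
    · have hx' : 0 < spectralValue (minpoly F x) :=
        lt_of_le_of_ne (spectralValue_nonneg _) fun h0 => hx (spectralValue_minpoly_eq_zero.1 h0.symm)
      have h3 : y = x * (x⁻¹ * y) := by rw [mul_inv_cancel_left₀ hx]
      have h4 : x + y = x * (1 + x⁻¹ * y) := by rw [mul_add, mul_one, ← h3]
      rw [h4, spectralValue_minpoly_mul φ h]
      refine mul_le_of_le_one_right hx'.le (h1 _ ?_)
      rw [h3, spectralValue_minpoly_mul φ h] at hxy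
      exact le_of_mul_le_mul_left (by rwa [mul_one]) hx'
  rcases le_total (spectralValue (minpoly F y)) (spectralValue (minpoly F x)) with hxy | hxy
  · exact (h2 x y hxy).trans (le_max_left _ _)
  · rw [add_comm]
    exact (h2 y x hxy).trans (le_max_right _ _)


/-- The unique norm on `D` that extends the norm on `F`. -/
noncomputable def spectralRingNorm : RingNorm D where
  toFun y := spectralValue (minpoly F y)
  map_zero' := spectralValue_minpoly_eq_zero.2 rfl
  add_le' x y := (spectralValue_minpoly_add_le φ h x y).trans
    (max_le_add_of_nonneg (spectralValue_nonneg _) (spectralValue_nonneg _))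
  neg' := spectralValue_minpoly_neg φ
  mul_le' x y := (spectralValue_minpoly_mul φ h x y).le
  eq_zero_of_map_eq_zero' _ := spectralValue_minpoly_eq_zero.1

/-- `D` as a normed ring. -/
@[reducible]
noncomputable def divisionNormedRing : NormedRing D := (spectralRingNorm φ h).toNormedRing

theorem divisionNorm_def (x : D) :
    (divisionNormedRing φ h).norm x = spectralValue (minpoly F x) := rfl

/-- `D` as a normed space over `F`. -/
@[reducible]
noncomputable def divisionNormedSpace :
    letI := divisionNormedRing φ h
    NormedSpace F D :=
  letI := divisionNormedRing φ h
  { (inferInstance : Module F D) with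
    norm_smul_le := fun a x => by
      rw [divisionNorm_def, divisionNorm_def, Algebra.smul_def, spectralValue_minpoly_mul φ h,
        spectralValue_minpoly_algebraMap] }

theorem divisionNorm_completeSpace : letI := divisionNormedRing φ h; CompleteSpace D := by
  let := divisionNormedRing φ h
  let := divisionNormedSpace φ h
  exact FiniteDimensional.complete F D

theorem divisionNorm_properSpace [ProperSpace F] :
    letI := divisionNormedRing φ h; ProperSpace D := by
  let := divisionNormedRing φ h
  let := divisionNormedSpace φ h
  exact FiniteDimensional.proper F D

theorem divisionNorm_topology_eq :
    (divisionNormedRing φ h).toMetricSpace.toUniformSpace.toTopologicalSpace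
      = moduleTopology F D := by
  let := divisionNormedRing φ h
  let := divisionNormedSpace φ h
  have := isModuleTopologyOfFiniteDimensional (𝕜 := F) (E := D)
  exact eq_moduleTopology F D

end SpectralNorm

/-! ### The abstract setting and its realization over a local field -/

/-- A division algebra `D` over a field `F` with compatible complete discrete valuations with finite
residue fields, together with a reduced norm, of degree `d` prime to the residue characteristic
`p`. -/
structure ValuedDivisionAlgebra (F D : Type*) [Field F] [DivisionRing D] [Algebra F D]
    (p d : ℕ) where
  w : Valuation F ℤᵐ⁰
  v : Valuation D ℤᵐ⁰
  N : D →* F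
  w_surjective : Function.Surjective w
  v_eq : ∀ x, v x = w (N x)
  N_algebraMap : ∀ a, N (algebraMap F D a) = a ^ d
  N_one_add : ∀ y, v y ≤ 1 → w (N (1 + y) - 1) ^ d ≤ v y
  w_natCast_lt_one_iff : ∀ n : ℕ, w (n : F) < 1 ↔ p ∣ n
  w_natCast_le_one : ∀ n : ℕ, w (n : F) ≤ 1
  coprime : p.Coprime d
  prime : p.Prime
  one_lt : 1 < d
  exists_root : ∀ u : F, w (u - 1) < 1 → ∃ r : F, r ^ d = u ∧ w (r - 1) < 1
  complete : ∀ x : ℕ → D, (∀ n : ℕ, v (x (n + 1) - x n) ≤ WithZero.exp (-(n : ℤ))) →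
    ∃ y, ∀ n : ℕ, v (y - x n) ≤ WithZero.exp (-(n : ℤ))
  finite_residue : ∃ s : Set D, s.Finite ∧ ∀ x, v x ≤ 1 → ∃ y ∈ s, v (x - y) < 1

section Construction

variable {F : Type*} [Field F] [ValuativeRel F] [TopologicalSpace F] [IsNonarchimedeanLocalField F]
  {D : Type*} [DivisionRing D] [Algebra F D] [FiniteDimensional F D]
  {n : ℕ} (φ : AlgebraicClosure F ⊗[F] D ≃ₐ[AlgebraicClosure F]
    Matrix (Fin n) (Fin n) (AlgebraicClosure F))
  (h : CharZero F ∨ ∃ p : ℕ, CharP F p ∧ ¬ p ∣ Module.finrank F D)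

include φ h

theorem localValuation_reducedNorm_le_iff (x y : D) :
    letI := localNormedField F
    localValuation F (reducedNorm F x) ≤ localValuation F (reducedNorm F y)
      ↔ spectralValue (minpoly F x) ≤ spectralValue (minpoly F y) := by
  let := localNormedField F
  have := localNorm_ultrametric F
  have := localNorm_completeSpace F
  rw [← localNorm_le_iff]
  change ‖reducedNorm F x‖ ≤ ‖reducedNorm F y‖ ↔ _
  rw [norm_reducedNorm φ h, norm_reducedNorm φ h]
  exact pow_le_pow_iff_left₀ (spectralValue_nonneg _) (spectralValue_nonneg _)
    (ne_zero_of_splitting φ)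

/-- The reduced norm as a monoid homomorphism. -/
noncomputable def reducedNormHom : D →* F where
  toFun := reducedNorm F
  map_one' := by
    have := reducedNorm_algebraMap φ h 1
    rwa [map_one, one_pow] at this
  map_mul' := reducedNorm_mul φ h

theorem reducedNorm_zero : reducedNorm F (0 : D) = 0 := by
  have := reducedNorm_algebraMap φ h 0
  rwa [map_zero, zero_pow (ne_zero_of_splitting φ)] at this

/-- The valuation on `D` given by the valuation of the reduced norm. -/
noncomputable def divisionValuation : Valuation D ℤᵐ⁰ where
  toFun x := localValuation F (reducedNorm F x)
  map_zero' := by rw [reducedNorm_zero φ h, map_zero]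
  map_one' := by
    have := (reducedNormHom φ h).map_one
    change localValuation F (reducedNormHom φ h 1) = 1
    rw [this, map_one]
  map_mul' x y := by rw [reducedNorm_mul φ h, map_mul]
  map_add_le_max' x y := by
    let := localNormedField F
    have := localNorm_ultrametric F
    have := localNorm_completeSpace F
    rw [le_max_iff, localValuation_reducedNorm_le_iff φ h, localValuation_reducedNorm_le_iff φ h,
      ← le_max_iff]
    exact spectralValue_minpoly_add_le φ h x y

theorem divisionValuation_le_iff (x y : D) :
    letI := localNormedField F
    divisionValuation φ h x ≤ divisionValuation φ h y ↔
      spectralValue (minpoly F x) ≤ spectralValue (minpoly F y) :=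
  localValuation_reducedNorm_le_iff φ h x y

/-- The exponent `n` absorbs the root in `spectralValue = ‖Nrd y‖ ^ (1 / n)`, so that no fractional
valuations occur. -/
theorem localValuation_reducedNorm_one_add (y : D) (hy : divisionValuation φ h y ≤ 1) :
    localValuation F (reducedNorm F (1 + y) - 1) ^ n ≤ divisionValuation φ h y := by
  let := localNormedField F
  have := localNorm_ultrametric F
  have := localNorm_completeSpace F
  rw [← map_one (divisionValuation φ h), divisionValuation_le_iff,
    ← map_one (algebraMap F D), spectralValue_minpoly_algebraMap, norm_one] at hy
  have h1 := pow_le_pow_left₀ (norm_nonneg _) (norm_reducedNorm_one_add_sub_one_le φ h y hy) n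
  rw [← norm_reducedNorm φ h, ← norm_pow] at h1
  change _ ≤ localValuation F (reducedNorm F y)
  rw [← map_pow, ← localNorm_le_iff]
  exact h1

variable {ϖ : D} (hϖ : divisionValuation φ h ϖ = WithZero.exp (-1))

include hϖ

theorem spectralValue_minpoly_uniformizer_lt_one :
    letI := localNormedField F; spectralValue (minpoly F ϖ) < 1 := by
  let := localNormedField F
  have := localNorm_ultrametric F
  have := localNorm_completeSpace F
  have h1 : ¬ divisionValuation φ h 1 ≤ divisionValuation φ h ϖ := by
    rw [hϖ, map_one, ← WithZero.exp_zero, WithZero.exp_le_exp]; norm_num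
  rw [divisionValuation_le_iff, ← map_one (algebraMap F D), spectralValue_minpoly_algebraMap,
    norm_one, not_le] at h1
  exact h1

theorem divisionValuation_le_exp_iff (x : D) (k : ℕ) :
    letI := localNormedField F
    divisionValuation φ h x ≤ WithZero.exp (-(k : ℤ)) ↔
      spectralValue (minpoly F x) ≤ spectralValue (minpoly F ϖ) ^ k := by
  let := localNormedField F
  have := localNorm_ultrametric F
  have := localNorm_completeSpace F
  have h1 : WithZero.exp (-(k : ℤ)) = divisionValuation φ h (ϖ ^ k) := by
    rw [map_pow, hϖ, ← WithZero.exp_nsmul]; simp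
  have h2 : spectralValue (minpoly F (ϖ ^ k)) = spectralValue (minpoly F ϖ) ^ k := by
    induction k with
    | zero =>
      rw [pow_zero, pow_zero, ← map_one (algebraMap F D), spectralValue_minpoly_algebraMap,
        norm_one]
    | succ k ih => rw [pow_succ, spectralValue_minpoly_mul φ h, ih, pow_succ]
                   rw [map_pow, hϖ, ← WithZero.exp_nsmul]; simp
  rw [h1, divisionValuation_le_iff, h2]

theorem divisionValuation_complete (x : ℕ → D)
    (hx : ∀ k : ℕ, divisionValuation φ h (x (k + 1) - x k) ≤ WithZero.exp (-(k : ℤ))) :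
    ∃ y, ∀ k : ℕ, divisionValuation φ h (y - x k) ≤ WithZero.exp (-(k : ℤ)) := by
  let := localNormedField F
  have := localNorm_ultrametric F
  have := localNorm_completeSpace F
  let := divisionNormedRing φ h
  let := divisionNormedSpace φ h
  have := divisionNorm_completeSpace φ h
  have hr := spectralValue_minpoly_uniformizer_lt_one φ h hϖ
  have hle : ∀ m k : ℕ, k ≤ m →
      divisionValuation φ h (x m - x k) ≤ WithZero.exp (-(k : ℤ)) := by
    intro m k hkm
    induction m, hkm using Nat.le_induction with
    | base => simp
    | succ m hkm ih =>
      rw [← sub_add_sub_cancel (x (m + 1)) (x m)]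
      refine (Valuation.map_add _ _ _).trans (max_le ((hx m).trans ?_) ih)
      rw [WithZero.exp_le_exp]
      omega
  simp only [divisionValuation_le_exp_iff φ h hϖ] at hx hle ⊢
  have hc : CauchySeq x := cauchySeq_of_le_geometric _ 1 hr fun k => by
    rw [dist_comm, one_mul, dist_eq_norm]
    exact hx k
  obtain ⟨y, hy⟩ := cauchySeq_tendsto_of_complete hc
  refine ⟨y, fun k => ?_⟩
  exact le_of_tendsto ((hy.sub_const (x k)).norm)
    (Filter.eventually_atTop.2 ⟨k, fun m hm => hle m k hm⟩)

omit hϖ in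
-- The closed unit ball of a finite-dimensional space over `F` is compact, hence covered by finitely
-- many open unit balls.
theorem divisionValuation_finite_residue : ∃ s : Set D, s.Finite ∧
    ∀ x, divisionValuation φ h x ≤ 1 → ∃ y ∈ s, divisionValuation φ h (x - y) < 1 := by
  let := localNormedField F
  have := localNorm_ultrametric F
  have := localNorm_completeSpace F
  have := localNorm_properSpace F
  let := divisionNormedRing φ h
  let := divisionNormedSpace φ h
  have := divisionNorm_properSpace φ h
  obtain ⟨t, _, ht, hst⟩ := (isCompact_closedBall (0 : D) 1).finite_cover_balls one_pos
  have h1 : spectralValue (minpoly F (1 : D)) = 1 := by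
    rw [← map_one (algebraMap F D), spectralValue_minpoly_algebraMap, norm_one]
  refine ⟨t, ht, fun x hx => ?_⟩
  rw [← map_one (divisionValuation φ h), divisionValuation_le_iff, h1] at hx
  obtain ⟨y, hy, hxy⟩ := Set.mem_iUnion₂.1 (hst (mem_closedBall_zero_iff.2 hx))
  refine ⟨y, hy, ?_⟩
  rw [← not_le, ← map_one (divisionValuation φ h), divisionValuation_le_iff, h1, not_le]
  rwa [Metric.mem_ball, dist_eq_norm] at hxy

/-- In finite dimension over a complete field the module topology is the norm topology, and balls of
radius a power of the norm of `ϖ` are the powers of the maximal ideal. -/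
theorem divisionValuation_mem_nhds_zero_iff [TopologicalSpace D] [IsModuleTopology F D]
    (s : Set D) : s ∈ nhds (0 : D) ↔
      ∃ k : ℕ, {x | divisionValuation φ h x ≤ WithZero.exp (-(k : ℤ))} ⊆ s := by
  let := localNormedField F
  have := localNorm_ultrametric F
  have := localNorm_completeSpace F
  have htop := (eq_moduleTopology F D).trans (divisionNorm_topology_eq φ h).symm
  let := divisionNormedRing φ h
  rw [htop]
  have h1 : 0 < spectralValue (minpoly F ϖ) := lt_of_le_of_ne (spectralValue_nonneg _) fun h0 => by
    rw [spectralValue_minpoly_eq_zero.1 h0.symm, map_zero] at hϖ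
    exact WithZero.exp_ne_zero hϖ.symm
  rw [(Metric.nhds_basis_closedBall_pow h1
    (spectralValue_minpoly_uniformizer_lt_one φ h hϖ)).mem_iff]
  have h2 : ∀ k : ℕ, {x | divisionValuation φ h x ≤ WithZero.exp (-(k : ℤ))}
      = Metric.closedBall 0 (spectralValue (minpoly F ϖ) ^ k) := by
    intro k
    ext x
    rw [mem_closedBall_zero_iff]
    exact divisionValuation_le_exp_iff φ h hϖ x k
  simp only [true_and, h2]

omit hϖ in
/-- The valued division algebra attached to a split central division algebra over a local field. -/
noncomputable def localDivisionAlgebra (p : ℕ) [Fact p.Prime] [CharP 𝓀[F] p] (hpn : p.Coprime n)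
    (hn : 1 < n) (hϖ : divisionValuation φ h ϖ = WithZero.exp (-1)) :
    ValuedDivisionAlgebra F D p n where
  w := localValuation F
  v := divisionValuation φ h
  N := reducedNormHom φ h
  w_surjective := localValuation_surjective F
  v_eq _ := rfl
  N_algebraMap := reducedNorm_algebraMap φ h
  N_one_add := localValuation_reducedNorm_one_add φ h
  w_natCast_lt_one_iff := localValuation_natCast_lt_one_iff F p
  w_natCast_le_one := localValuation_natCast_le_one F
  coprime := hpn
  prime := Fact.out
  one_lt := hn
  exists_root _ hu := exists_pow_eq_of_localValuation_sub_one_lt F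
    (localValuation_natCast_eq_one F p n
      (((Fact.out : p.Prime).coprime_iff_not_dvd).1 hpn)) hu
  complete := divisionValuation_complete φ h hϖ
  finite_residue := divisionValuation_finite_residue φ h

end Construction

/-! ### Powers of the maximal ideal and the residue field -/

namespace ValuedDivisionAlgebra

variable {F D : Type*} [Field F] [DivisionRing D] [Algebra F D] {p d : ℕ}
  (S : ValuedDivisionAlgebra F D p d)

/-- The `i`-th power of the maximal ideal of `D`. -/
def M (i : ℕ) : AddSubgroup D where
  carrier := {x | S.v x ≤ WithZero.exp (-(i : ℤ))}
  zero_mem' := by simp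
  add_mem' {x y} hx hy := (S.v.map_add x y).trans (max_le hx hy)
  neg_mem' {x} hx := by simpa [Valuation.map_neg] using hx

variable {S} {i j : ℕ} {x y z : D}

theorem mem_M : x ∈ S.M i ↔ S.v x ≤ WithZero.exp (-(i : ℤ)) := Iff.rfl

theorem mem_M_zero : x ∈ S.M 0 ↔ S.v x ≤ 1 := by simp [mem_M]

theorem mem_M_succ : x ∈ S.M (i + 1) ↔ S.v x < WithZero.exp (-(i : ℤ)) := by
  rw [mem_M]
  by_cases hx : S.v x = 0
  · simp [hx]
  · rw [← WithZero.exp_log hx, WithZero.exp_lt_exp, WithZero.exp_le_exp]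
    push_cast
    omega

theorem mem_M_one : x ∈ S.M 1 ↔ S.v x < 1 := by simpa using mem_M_succ (S := S) (i := 0) (x := x)

theorem M_mono (h : i ≤ j) : S.M j ≤ S.M i := fun x hx => by
  rw [mem_M] at hx ⊢
  refine hx.trans ?_
  rw [WithZero.exp_le_exp]
  omega

theorem mul_mem_M (hx : x ∈ S.M i) (hy : y ∈ S.M j) : x * y ∈ S.M (i + j) := by
  rw [mem_M] at hx hy ⊢
  rw [map_mul]
  refine (mul_le_mul' hx hy).trans_eq ?_
  rw [← WithZero.exp_add]
  push_cast
  congr 1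
  ring

theorem mul_mem_M_left (hx : x ∈ S.M 0) (hy : y ∈ S.M j) : x * y ∈ S.M j := by
  simpa using mul_mem_M hx hy

theorem mul_mem_M_right (hx : x ∈ S.M i) (hy : y ∈ S.M 0) : x * y ∈ S.M i := by
  simpa using mul_mem_M hx hy

theorem one_mem_M : (1 : D) ∈ S.M 0 := by simp [mem_M_zero]

theorem pow_mem_M_zero (hx : x ∈ S.M 0) (n : ℕ) : x ^ n ∈ S.M 0 := by
  rw [mem_M_zero] at hx ⊢
  rw [map_pow]
  exact pow_le_one' hx n

theorem natCast_mem_M (n : ℕ) : (n : D) ∈ S.M 0 := by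
  induction n with
  | zero => simpa using zero_mem _
  | succ n ih => simpa using add_mem ih one_mem_M

theorem mem_M_zero_of_unit (h : S.v x = 1) : x ∈ S.M 0 := mem_M_zero.2 h.le

theorem inv_mem_M_zero (h : S.v x = 1) : x⁻¹ ∈ S.M 0 :=
  mem_M_zero_of_unit (by rw [map_inv₀, h, inv_one])

theorem unit_of_mem_of_notMem (h : x ∈ S.M 0) (h' : x ∉ S.M 1) : S.v x = 1 := by
  rw [mem_M_one, not_lt] at h'
  exact (mem_M_zero.1 h).antisymm h'

theorem ne_zero_of_v_eq {n : ℤ} (h : S.v x = WithZero.exp n) : x ≠ 0 := by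
  rintro rfl
  rw [map_zero] at h
  exact WithZero.exp_ne_zero h.symm

theorem ne_zero_of_unit (h : S.v x = 1) : x ≠ 0 := by
  rintro rfl
  simp at h

theorem eq_zero_of_forall_v_le {γ : ℤᵐ⁰} (hγ : γ ≠ 0)
    (h : ∀ n : ℕ, S.v x ≤ γ * WithZero.exp (-(n : ℤ))) : x = 0 := by
  by_contra hx
  have hx' : γ⁻¹ * S.v x ≠ 0 := mul_ne_zero (inv_ne_zero hγ) ((Valuation.ne_zero_iff _).2 hx)
  obtain ⟨n, hn⟩ := WithZero.exists_exp_neg_natCast_lt hx'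
  have h1 := mul_le_mul_right (h n) γ⁻¹
  rw [inv_mul_cancel_left₀ hγ] at h1
  exact absurd (hn.trans_le h1) (lt_irrefl _)

theorem eq_zero_of_forall_mem (h : ∀ n : ℕ, x ∈ S.M n) : x = 0 :=
  eq_zero_of_forall_v_le one_ne_zero fun n => by rw [one_mul]; exact h n

theorem v_eq_of_sub_mem (hx : S.v x = WithZero.exp (-(i : ℤ))) (h : y - x ∈ S.M (i + 1)) :
    S.v y = WithZero.exp (-(i : ℤ)) := by
  rw [← hx]
  refine Valuation.map_eq_of_sub_lt _ ?_
  rw [hx]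
  exact mem_M_succ.1 h

theorem v_eq_one_of_sub_mem (hx : S.v x = 1) (h : y - x ∈ S.M 1) : S.v y = 1 := by
  simpa using v_eq_of_sub_mem (i := 0) (by simpa using hx) h

theorem pow_sub_pow_mem (hx : x ∈ S.M 0) (hy : y ∈ S.M 0) (h : x - y ∈ S.M i) (n : ℕ) :
    x ^ n - y ^ n ∈ S.M i := by
  induction n with
  | zero => simp
  | succ n ih =>
    have : x ^ (n + 1) - y ^ (n + 1) = x ^ n * (x - y) + (x ^ n - y ^ n) * y := by
      rw [pow_succ, pow_succ]; noncomm_ring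
    rw [this]
    exact add_mem (mul_mem_M_left (pow_mem_M_zero hx n) h) (mul_mem_M_right ih hy)

/-- Raising to the `Q`-th power, for `Q` in the maximal ideal, contracts commuting pairs. -/
theorem pow_sub_pow_mem_succ {Q : ℕ} (hQ : (Q : D) ∈ S.M 1) (hx : x ∈ S.M 0) (hy : y ∈ S.M 0)
    (hxy : Commute x y) (hi : 1 ≤ i) (h : x - y ∈ S.M i) : x ^ Q - y ^ Q ∈ S.M (i + 1) := by
  rw [← hxy.mul_geom_sum₂]
  refine mul_mem_M h ?_
  have key : ∑ k ∈ Finset.range Q, (x ^ k * y ^ (Q - 1 - k) - y ^ (Q - 1)) ∈ S.M 1 := by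
    refine sum_mem fun k hk => ?_
    have hk' : y ^ (Q - 1) = y ^ k * y ^ (Q - 1 - k) := by
      rw [← pow_add]
      congr 1
      have := Finset.mem_range.1 hk
      omega
    rw [hk', ← sub_mul]
    exact mul_mem_M_right (pow_sub_pow_mem hx hy (M_mono hi h) k) (pow_mem_M_zero hy _)
  rw [Finset.sum_sub_distrib, Finset.sum_const, Finset.card_range, nsmul_eq_mul] at key
  have := add_mem key (mul_mem_M_right hQ (pow_mem_M_zero hy (Q - 1)))
  rwa [sub_add_cancel] at this

/-- Uniqueness of Teichmüller lifts among commuting elements: taking `Q`-th powers fixes both but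
improves their congruence indefinitely. -/
theorem eq_of_pow_eq_of_sub_mem {Q : ℕ} (hQ : (Q : D) ∈ S.M 1) (hx : x ∈ S.M 0) (hy : y ∈ S.M 0)
    (hxy : Commute x y) (hxQ : x ^ Q = x) (hyQ : y ^ Q = y) (h : x - y ∈ S.M 1) : x = y := by
  have key : ∀ n : ℕ, x - y ∈ S.M (n + 1) := by
    intro n
    induction n with
    | zero => exact h
    | succ n ih =>
      have := pow_sub_pow_mem_succ hQ hx hy hxy (Nat.le_add_left 1 n) ih
      rwa [hxQ, hyQ] at this
  exact sub_eq_zero.1 (eq_zero_of_forall_mem fun n => M_mono (Nat.le_succ n) (key n))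

section Residue

variable (S)

/-- The maximal ideal of the ring of integers. -/
def maxIdeal : Ideal S.v.integer where
  carrier := {x | S.v (x : D) < 1}
  zero_mem' := by simp
  add_mem' {x y} hx hy := S.v.map_add_lt hx hy
  smul_mem' c x hx := by
    change S.v ((c : D) * (x : D)) < 1
    rw [map_mul]
    exact (mul_le_of_le_one_left' c.2).trans_lt hx

instance : S.maxIdeal.IsTwoSided where
  mul_mem_of_left {a} b ha := by
    change S.v ((a : D) * (b : D)) < 1
    rw [map_mul]
    exact (mul_le_of_le_one_right' b.2).trans_lt ha

theorem mem_maxIdeal (x : S.v.integer) : x ∈ S.maxIdeal ↔ (x : D) ∈ S.M 1 :=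
  mem_M_one.symm

theorem mk_eq_mk_iff (x y : S.v.integer) :
    Ideal.Quotient.mk S.maxIdeal x = Ideal.Quotient.mk S.maxIdeal y ↔ (x - y : D) ∈ S.M 1 := by
  rw [Ideal.Quotient.mk_eq_mk_iff_sub_mem, mem_maxIdeal]
  rfl

instance : IsDomain (S.v.integer ⧸ S.maxIdeal) := by
  have : Nontrivial (S.v.integer ⧸ S.maxIdeal) := by
    refine ⟨Ideal.Quotient.mk _ 1, Ideal.Quotient.mk _ 0, ?_⟩
    rw [Ne, mk_eq_mk_iff, mem_M_one]
    simp
  have : NoZeroDivisors (S.v.integer ⧸ S.maxIdeal) := ⟨fun {a b} hab => by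
    obtain ⟨a, rfl⟩ := Ideal.Quotient.mk_surjective a
    obtain ⟨b, rfl⟩ := Ideal.Quotient.mk_surjective b
    rw [← map_mul, ← map_zero (Ideal.Quotient.mk S.maxIdeal), mk_eq_mk_iff, mem_M_one] at hab
    rw [← map_zero (Ideal.Quotient.mk S.maxIdeal), mk_eq_mk_iff, mk_eq_mk_iff, mem_M_one, mem_M_one]
    by_contra! h
    have ha := h.1
    have hb := h.2
    simp only [ZeroMemClass.coe_zero, sub_zero, Subring.coe_mul, map_mul] at ha hb hab
    exact absurd (one_le_mul ha hb) (not_le.2 hab)⟩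
  exact NoZeroDivisors.to_isDomain _

instance : Finite (S.v.integer ⧸ S.maxIdeal) := by
  obtain ⟨s, hs, hs'⟩ := S.finite_residue
  have : Finite s := hs
  refine Finite.of_injective (β := s) (fun a =>
    ⟨(hs' _ (Function.surjInv Ideal.Quotient.mk_surjective a).2).choose,
      (hs' _ (Function.surjInv Ideal.Quotient.mk_surjective a).2).choose_spec.1⟩) ?_
  intro a b hab
  have ha := (hs' _ (Function.surjInv Ideal.Quotient.mk_surjective a).2).choose_spec.2
  have hb := (hs' _ (Function.surjInv Ideal.Quotient.mk_surjective b).2).choose_spec.2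
  rw [Subtype.mk.injEq] at hab
  rw [hab] at ha
  rw [← mem_M_one] at ha hb
  have h := sub_mem ha hb
  rw [sub_sub_sub_cancel_right, ← mk_eq_mk_iff] at h
  rwa [Function.surjInv_eq Ideal.Quotient.mk_surjective,
    Function.surjInv_eq Ideal.Quotient.mk_surjective] at h

variable {S}

/-- Wedderburn: the residue ring is a finite domain, hence commutative. -/
theorem mul_sub_mul_mem_M_one (hx : x ∈ S.M 0) (hy : y ∈ S.M 0) : x * y - y * x ∈ S.M 1 := by
  rw [mem_M_zero] at hx hy
  have h := (Finite.isDomain_to_isField (S.v.integer ⧸ S.maxIdeal)).mul_comm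
    (Ideal.Quotient.mk _ ⟨x, hx⟩) (Ideal.Quotient.mk _ ⟨y, hy⟩)
  rwa [← map_mul, ← map_mul, mk_eq_mk_iff] at h

variable (S)

/-- The residue field has `Q` elements, and `g` lifts a generator of its cyclic unit group. -/
theorem exists_residue_generator : ∃ Q : ℕ, 1 < Q ∧ (Q : D) ∈ S.M 1 ∧ ∃ g ∈ S.M 0,
    (∀ x ∈ S.M 0, x ∈ S.M 1 ∨ ∃ i : ℕ, x - g ^ i ∈ S.M 1) ∧ g ^ Q - g ∈ S.M 1 ∧
    g ∉ S.M 1 := by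
  let k := S.v.integer ⧸ S.maxIdeal
  let : Field k := (Finite.isDomain_to_isField k).toField
  have : Fintype k := Fintype.ofFinite k
  obtain ⟨g, hg⟩ := IsCyclic.exists_generator (α := kˣ)
  obtain ⟨g', hg'⟩ := Ideal.Quotient.mk_surjective (I := S.maxIdeal) (g : k)
  refine ⟨Fintype.card k, Fintype.one_lt_card, ?_, g', mem_M_zero.2 g'.2, fun x hx => ?_, ?_, ?_⟩
  · have h := Nat.cast_card_eq_zero k
    have h' : Ideal.Quotient.mk S.maxIdeal (Fintype.card k : S.v.integer) =
        Ideal.Quotient.mk S.maxIdeal 0 := by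
      rw [map_natCast, map_zero]
      exact h
    rw [mk_eq_mk_iff] at h'
    simpa using h'
  · rw [mem_M_zero] at hx
    by_cases h0 : Ideal.Quotient.mk S.maxIdeal ⟨x, hx⟩ = 0
    · left
      rw [← map_zero (Ideal.Quotient.mk S.maxIdeal), mk_eq_mk_iff] at h0
      simpa using h0
    · right
      let u : kˣ := Units.mk0 (Ideal.Quotient.mk S.maxIdeal ⟨x, hx⟩) h0
      obtain ⟨i, hi⟩ := (mem_powers_iff_mem_zpowers (x := g) (y := u)).2 (hg u)
      refine ⟨i, ?_⟩
      have h : (g : k) ^ i = Ideal.Quotient.mk S.maxIdeal ⟨x, hx⟩ := congrArg Units.val hi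
      rw [← hg'] at h
      have h' : Ideal.Quotient.mk S.maxIdeal ⟨x, hx⟩ = Ideal.Quotient.mk S.maxIdeal (g' ^ i) :=
        h.symm
      rw [mk_eq_mk_iff] at h'
      exact h'
  · have h := FiniteField.pow_card (g : k)
    rw [← hg'] at h
    have h' : Ideal.Quotient.mk S.maxIdeal (g' ^ Fintype.card k) = Ideal.Quotient.mk S.maxIdeal g' :=
      h
    rw [mk_eq_mk_iff] at h'
    exact h'
  · intro h
    have h' : Ideal.Quotient.mk S.maxIdeal g' = Ideal.Quotient.mk S.maxIdeal 0 := by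
      rw [mk_eq_mk_iff]
      simpa using h
    rw [hg', map_zero] at h'
    exact g.ne_zero h'

end Residue

end ValuedDivisionAlgebra

/-! ### Teichmüller lifts and a normalizing uniformizer -/

namespace ValuedDivisionAlgebra

variable {F D : Type*} [Field F] [DivisionRing D] [Algebra F D] {p d : ℕ}
  {S : ValuedDivisionAlgebra F D p d} {i j : ℕ} {x y z : D}

theorem v_algebraMap (a : F) : S.v (algebraMap F D a) = S.w a ^ d := by
  rw [S.v_eq, S.N_algebraMap, map_pow]

variable (S) in
/-- Teichmüller lifts. -/
theorem exists_teichmuller {Q : ℕ} (hQ : (Q : D) ∈ S.M 1) {g : D} (hg : g ∈ S.M 0)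
    (hgQ : g ^ Q - g ∈ S.M 1) : ∃ ζ ∈ S.M 0, ζ ^ Q = ζ ∧ ζ - g ∈ S.M 1 := by
  have h0 : ∀ k : ℕ, g ^ Q ^ k ∈ S.M 0 := fun k => pow_mem_M_zero hg _
  have hstep : ∀ k : ℕ, g ^ Q ^ (k + 1) - g ^ Q ^ k ∈ S.M (k + 1) := by
    intro k
    induction k with
    | zero => simpa using hgQ
    | succ k ih =>
      rw [pow_succ Q (k + 1), pow_mul]
      have h2 : g ^ Q ^ (k + 1) = (g ^ Q ^ k) ^ Q := by rw [← pow_mul, ← pow_succ]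
      nth_rewrite 2 [h2]
      exact pow_sub_pow_mem_succ hQ (h0 _) (h0 _) ((Commute.refl g).pow_pow _ _)
        (Nat.le_add_left 1 k) ih
  obtain ⟨ζ, hζ⟩ := S.complete (fun k => g ^ Q ^ k) fun k => M_mono (Nat.le_succ k) (hstep k)
  change ∀ n, ζ - g ^ Q ^ n ∈ S.M n at hζ
  have hζ0 : ζ ∈ S.M 0 := by
    have := add_mem (hζ 0) (h0 0)
    rwa [sub_add_cancel] at this
  have hcomm : Commute ζ g := by
    rw [commute_iff_eq, ← sub_eq_zero]
    refine eq_zero_of_forall_mem (S := S) fun n => ?_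
    have h1 : ζ * g - g * ζ = (ζ - g ^ Q ^ n) * g - g * (ζ - g ^ Q ^ n) := by
      rw [sub_mul, mul_sub, ← pow_succ, ← pow_succ']
      abel
    rw [h1]
    exact sub_mem (mul_mem_M_right (hζ n) hg) (mul_mem_M_left hg (hζ n))
  refine ⟨ζ, hζ0, ?_, ?_⟩
  · rw [← sub_eq_zero]
    refine eq_zero_of_forall_mem (S := S) fun n => ?_
    have h1 : ζ ^ Q - g ^ Q ^ (n + 1) ∈ S.M n := by
      rw [pow_succ, pow_mul]
      exact pow_sub_pow_mem hζ0 (h0 n) (hζ n) Q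
    have h2 := sub_mem h1 (M_mono (Nat.le_succ n) (hζ (n + 1)))
    rwa [sub_sub_sub_cancel_right] at h2
  · have h1 := hζ 1
    rw [pow_one] at h1
    have := add_mem h1 hgQ
    rwa [sub_add_sub_cancel] at this

theorem M_conj {ϖ : D} (hϖ : ϖ ≠ 0) (hx : x ∈ S.M i) : ϖ * x * ϖ⁻¹ ∈ S.M i := by
  have h : S.v ϖ ≠ 0 := (Valuation.ne_zero_iff _).2 hϖ
  rw [mem_M, map_mul, map_mul, map_inv₀, mul_comm (S.v ϖ), mul_inv_cancel_right₀ h]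
  exact hx

theorem unit_conj_sub_mem {u : D} (hu : S.v u = 1) (hx : x ∈ S.M 0) : u * x * u⁻¹ - x ∈ S.M 1 := by
  have h : u * x * u⁻¹ - x = (u * x - x * u) * u⁻¹ := by
    rw [sub_mul, mul_assoc x, mul_inv_cancel₀ (ne_zero_of_unit hu), mul_one]
  rw [h]
  exact mul_mem_M_right (mul_sub_mul_mem_M_one (mem_M_zero_of_unit hu) hx) (inv_mem_M_zero hu)

/-- Conjugation on the residue field only depends on the valuation. -/
theorem conj_sub_conj_mem {a b : D} (ha : a ≠ 0) (hab : S.v a = S.v b) (hx : x ∈ S.M 0) :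
    a * x * a⁻¹ - b * x * b⁻¹ ∈ S.M 1 := by
  have hva : S.v a ≠ 0 := (Valuation.ne_zero_iff _).2 ha
  have hb : b ≠ 0 := by
    rintro rfl
    rw [map_zero] at hab
    exact hva hab
  have hu : S.v (a * b⁻¹) = 1 := by rw [map_mul, map_inv₀, ← hab, mul_inv_cancel₀ hva]
  have h := unit_conj_sub_mem hu (M_conj hb hx)
  have h1 : a * b⁻¹ * (b * x * b⁻¹) * (a * b⁻¹)⁻¹ = a * x * a⁻¹ := by
    rw [mul_inv_rev, inv_inv, mul_assoc b, ← mul_assoc (a * b⁻¹), inv_mul_cancel_right₀ hb,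
      ← mul_assoc a x, mul_assoc (a * x), inv_mul_cancel_left₀ hb]
  rwa [h1] at h

variable {ϖ : D} (hϖ : S.v ϖ = WithZero.exp (-1))

include hϖ

theorem v_pow_uniformizer (n : ℕ) : S.v (ϖ ^ n) = WithZero.exp (-(n : ℤ)) := by
  rw [map_pow, hϖ, ← WithZero.exp_nsmul]
  simp

theorem uniformizer_ne_zero : ϖ ≠ 0 := ne_zero_of_v_eq hϖ

theorem mul_inv_pow_mem {i j : ℕ} (hx : x ∈ S.M (i + j)) : x * (ϖ ^ j)⁻¹ ∈ S.M i := by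
  rw [mem_M, map_mul, map_inv₀, v_pow_uniformizer hϖ, ← WithZero.exp_neg, neg_neg]
  refine (mul_le_mul_left hx _).trans_eq ?_
  rw [← WithZero.exp_add]
  congr 1
  push_cast
  ring

theorem inv_pow_mul_mem {i j : ℕ} (hx : x ∈ S.M (i + j)) : (ϖ ^ j)⁻¹ * x ∈ S.M i := by
  have := mul_inv_pow_mem hϖ hx
  rw [mem_M] at this ⊢
  rwa [map_mul, mul_comm, ← map_mul]

theorem uniformizer_mem : ϖ ∈ S.M 1 := by rw [mem_M, hϖ]; rfl

theorem uniformizer_pow_mem (n : ℕ) : ϖ ^ n ∈ S.M n := (v_pow_uniformizer hϖ n).le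

variable (S) in
omit hϖ in
theorem exists_algebraMap_v_eq (m : ℕ) :
    ∃ a : F, S.w a = WithZero.exp (-(m : ℤ)) ∧
      S.v (algebraMap F D a) = WithZero.exp (-((d * m : ℕ) : ℤ)) := by
  obtain ⟨a, ha⟩ := S.w_surjective (WithZero.exp (-(m : ℤ)))
  refine ⟨a, ha, ?_⟩
  rw [v_algebraMap, ha, ← WithZero.exp_nsmul]
  simp

/-- Elements commuting with lifts of a residue generator and of a uniformizer are central. -/
theorem exists_eq_algebraMap_of_commute [Algebra.IsCentral F D] {ζ : D}
    (hgen : ∀ x ∈ S.M 0, x ∈ S.M 1 ∨ ∃ i : ℕ, x - ζ ^ i ∈ S.M 1) {η : D}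
    (h1 : Commute η ζ) (h2 : Commute η ϖ) : ∃ a : F, η = algebraMap F D a := by
  rw [← Algebra.IsCentral.mem_center_iff F]
  -- Peel off the digits of `z`: each is `0` or a power of `ζ`, times a power of `ϖ`, and these
  -- commute with `η`.
  have happrox : ∀ z ∈ S.M 0, ∀ n : ℕ, ∃ z', Commute η z' ∧ z - z' ∈ S.M n := by
    intro z hz n
    induction n with
    | zero => exact ⟨0, Commute.zero_right η, by simpa using hz⟩
    | succ n ih =>
      obtain ⟨z', hc, hz'⟩ := ih
      have hw : (z - z') * (ϖ ^ n)⁻¹ ∈ S.M 0 := mul_inv_pow_mem hϖ (by simpa using hz')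
      have hne : ϖ ^ n ≠ 0 := pow_ne_zero _ (uniformizer_ne_zero hϖ)
      have hs : ∀ c : D, (z - z') * (ϖ ^ n)⁻¹ - c ∈ S.M 1 → z - (z' + c * ϖ ^ n) ∈ S.M (n + 1) := by
        intro c hcc
        have h3 := mul_mem_M hcc (uniformizer_pow_mem hϖ n)
        rwa [sub_mul, inv_mul_cancel_right₀ hne, add_comm 1 n, sub_sub] at h3
      rcases hgen _ hw with h | ⟨i, h⟩
      · exact ⟨z', hc, by simpa using hs 0 (by simpa using h)⟩
      · exact ⟨z' + ζ ^ i * ϖ ^ n, hc.add_right ((h1.pow_right i).mul_right (h2.pow_right n)),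
          hs _ h⟩
  have hint : ∀ z ∈ S.M 0, Commute η z := by
    intro z hz
    rcases eq_or_ne η 0 with rfl | hη
    · exact Commute.zero_left z
    rw [commute_iff_eq, ← sub_eq_zero]
    refine eq_zero_of_forall_v_le (S := S) (γ := S.v η) ((Valuation.ne_zero_iff _).2 hη) fun n => ?_
    obtain ⟨z', hc, hz'⟩ := happrox z hz n
    have h3 : η * z - z * η = η * (z - z') - (z - z') * η := by
      rw [mul_sub, sub_mul, hc.eq]
      abel
    rw [h3]
    refine (Valuation.map_sub _ _ _).trans (max_le ?_ ?_)
    · rw [map_mul]; exact mul_le_mul_right hz' _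
    · rw [map_mul, mul_comm]; exact mul_le_mul_right hz' _
  rw [Subalgebra.mem_center_iff]
  intro b
  rcases eq_or_ne b 0 with rfl | hb
  · simp
  obtain ⟨k, hk⟩ := WithZero.exists_exp_neg_natCast_lt
    (inv_ne_zero ((Valuation.ne_zero_iff S.v).2 hb))
  have hbk : b * ϖ ^ k ∈ S.M 0 := by
    rw [mem_M_zero, map_mul, v_pow_uniformizer hϖ]
    have := mul_le_mul_right hk.le (S.v b)
    rwa [mul_inv_cancel₀ ((Valuation.ne_zero_iff S.v).2 hb)] at this
  have h3 := (hint _ hbk).mul_right ((h2.pow_right k).inv_right₀)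
  rw [mul_inv_cancel_right₀ (pow_ne_zero _ (uniformizer_ne_zero hϖ))] at h3
  exact h3.eq.symm

/-- The existence of a Teichmüller generator normalized by a uniformizer. -/
theorem exists_normalized_generators : ∃ Q : ℕ, (Q : D) ∈ S.M 1 ∧ ∃ ζ τ : D, S.v ζ = 1 ∧
    ζ ^ Q = ζ ∧ S.v τ = WithZero.exp (-1) ∧
    (∀ x ∈ S.M 0, x ∈ S.M 1 ∨ ∃ i : ℕ, x - ζ ^ i ∈ S.M 1) ∧ ∃ j : ℕ, τ * ζ = ζ ^ j * τ := by
  obtain ⟨Q, hQ1, hQ, g, hg, hgen, hgQ, hg1⟩ := S.exists_residue_generator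
  obtain ⟨ζ, hζ0, hζQ, hζg⟩ := S.exists_teichmuller hQ hg hgQ
  have hgen' : ∀ x ∈ S.M 0, x ∈ S.M 1 ∨ ∃ i : ℕ, x - ζ ^ i ∈ S.M 1 := by
    intro x hx
    refine (hgen x hx).imp_right fun ⟨i, hi⟩ => ⟨i, ?_⟩
    have h := sub_mem hi (pow_sub_pow_mem hζ0 hg hζg i)
    rwa [sub_sub_sub_cancel_right] at h
  have hζ1 : S.v ζ = 1 := by
    refine unit_of_mem_of_notMem hζ0 fun h => hg1 ?_
    simpa using sub_mem h hζg
  have hζne : ζ ≠ 0 := ne_zero_of_unit hζ1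
  have hϖ0 := uniformizer_ne_zero hϖ
  have hconj : ϖ * ζ * ϖ⁻¹ ∈ S.M 0 := M_conj hϖ0 hζ0
  obtain ⟨j, hj⟩ : ∃ j : ℕ, ϖ * ζ * ϖ⁻¹ - ζ ^ j ∈ S.M 1 := by
    refine (hgen' _ hconj).resolve_left fun h => ?_
    rw [mem_M_one, map_mul, map_mul, map_inv₀, hζ1, mul_one,
      mul_inv_cancel₀ ((Valuation.ne_zero_iff _).2 hϖ0)] at h
    exact lt_irrefl _ h
  obtain ⟨q, rfl⟩ : ∃ q, Q = q + 1 := ⟨Q - 1, by omega⟩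
  have hζq : ζ ^ q = 1 := by
    rw [pow_succ] at hζQ
    exact mul_right_cancel₀ hζne (by rwa [one_mul])
  set c := ζ ^ j with hc
  have hcne : c ≠ 0 := pow_ne_zero _ hζne
  have hc1 : S.v c = 1 := by rw [hc, map_pow, hζ1, one_pow]
  -- Averaging `ϖ` under the operator `x ↦ c⁻¹ * x * ζ`, whose `q`-th power is the identity,
  -- projects it to a fixed vector, that is, to a solution of `τ * ζ = c * τ`.
  let f : ℕ → D := fun i => (c⁻¹) ^ i * ϖ * ζ ^ i
  have hf0 : f 0 = ϖ := by simp [f]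
  have hfq : f q = ϖ := by
    simp only [f]
    rw [hζq, mul_one, inv_pow, hc, ← pow_mul, mul_comm j q, pow_mul, hζq, one_pow, inv_one, one_mul]
  have hf : ∀ i, f i - ϖ ∈ S.M 2 := by
    intro i
    have h1 : (ϖ * ζ * ϖ⁻¹) ^ i = ϖ * ζ ^ i * ϖ⁻¹ := by
      induction i with
      | zero => simp [hϖ0]
      | succ i ih => rw [pow_succ, ih, pow_succ]; simp [mul_assoc, hϖ0]
    have h2 := pow_sub_pow_mem hconj (mem_M_zero_of_unit hc1) hj i
    rw [h1] at h2
    have h3 := mul_mem_M (mul_mem_M_left (pow_mem_M_zero (inv_mem_M_zero hc1) i) h2)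
      (uniformizer_mem hϖ)
    have h4 : (c⁻¹) ^ i * (ϖ * ζ ^ i * ϖ⁻¹ - c ^ i) * ϖ = f i - ϖ := by
      simp only [f]
      rw [mul_sub, sub_mul, ← mul_assoc, ← mul_assoc, inv_mul_cancel_right₀ hϖ0, inv_pow,
        inv_mul_cancel₀ (pow_ne_zero _ hcne), one_mul]
    rwa [h4] at h3
  refine ⟨q + 1, hQ, ζ, ∑ i ∈ Finset.range q, f i, hζ1, hζQ, ?_, hgen', j, ?_⟩
  -- All `q` summands are `ϖ` modulo `M 2`, and `q = Q - 1` is congruent to `-1`, so the sum has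
  -- leading term `-ϖ` and is again a uniformizer.
  · have h1 : ∑ i ∈ Finset.range q, (f i - ϖ) ∈ S.M 2 := sum_mem fun i _ => hf i
    rw [Finset.sum_sub_distrib, Finset.sum_const, Finset.card_range, nsmul_eq_mul] at h1
    have h2 := add_mem h1 (mul_mem_M hQ (uniformizer_mem hϖ))
    have h3 : ∑ i ∈ Finset.range q, f i - q * ϖ + ((q + 1 : ℕ) : D) * ϖ =
        ∑ i ∈ Finset.range q, f i - -ϖ := by
      push_cast
      rw [add_mul, one_mul]
      abel
    rw [h3] at h2
    exact v_eq_of_sub_mem (i := 1) (by rw [Valuation.map_neg, hϖ]; rfl) h2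
  · have h1 : ∀ i, c * f (i + 1) = f i * ζ := by
      intro i
      simp only [f]
      rw [pow_succ' c⁻¹, pow_succ ζ, mul_assoc c⁻¹, mul_assoc c⁻¹, mul_inv_cancel_left₀ hcne]
      simp [mul_assoc]
    rw [Finset.sum_mul, Finset.sum_congr rfl fun i _ => (h1 i).symm, ← Finset.mul_sum]
    congr 1
    have h2 := Finset.sum_range_succ f q
    rw [Finset.sum_range_succ', hf0, hfq] at h2
    exact add_right_cancel h2

end ValuedDivisionAlgebra

/-! ### Conjugation by a uniformizer on the residue field -/

namespace ValuedDivisionAlgebra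

variable {F D : Type*} [Field F] [DivisionRing D] [Algebra F D] {p d : ℕ}
  {S : ValuedDivisionAlgebra F D p d} {i j : ℕ} {x y z : D}
  {ϖ : D} (hϖ : S.v ϖ = WithZero.exp (-1))

theorem dvd_of_v_algebraMap_eq {a : F} {n : ℕ}
    (h : S.v (algebraMap F D a) = WithZero.exp (-(n : ℤ))) : d ∣ n := by
  have ha : S.w a ≠ 0 := by
    intro ha
    rw [v_algebraMap, ha, zero_pow (by have := S.one_lt; omega)] at h
    exact WithZero.exp_ne_zero h.symm
  rw [v_algebraMap, ← WithZero.exp_log ha, ← WithZero.exp_nsmul, WithZero.exp_inj, nsmul_eq_mul] at h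
  have : (d : ℤ) ∣ n := ⟨-WithZero.log (S.w a), by rw [mul_neg, h, neg_neg]⟩
  exact_mod_cast this

include hϖ

/-- If `σ ^ n` were trivial, uniqueness of Teichmüller lifts would make `τ ^ n` commute with `ζ`
exactly, hence be central, and its valuation `n` would be divisible by `d`. -/
theorem exists_conj_pow_sub_notMem [Algebra.IsCentral F D] {n : ℕ} (hn : ¬ d ∣ n) :
    ∃ t ∈ S.M 0, ϖ ^ n * t * (ϖ ^ n)⁻¹ - t ∉ S.M 1 := by
  by_contra! hall
  apply hn
  obtain ⟨Q, hQ, ζ, τ, hζ1, hζQ, hτ, hgen, j, hj⟩ := exists_normalized_generators hϖ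
  have hζ0 := mem_M_zero_of_unit hζ1
  have hτn := pow_ne_zero n (uniformizer_ne_zero hτ)
  have h1 := add_mem (conj_sub_conj_mem hτn
    ((v_pow_uniformizer hτ n).trans (v_pow_uniformizer hϖ n).symm) hζ0) (hall ζ hζ0)
  rw [sub_add_sub_cancel] at h1
  have h2 : ∀ k : ℕ, ∃ m : ℕ, τ ^ k * ζ = ζ ^ m * τ ^ k := by
    intro k
    induction k with
    | zero => exact ⟨1, by simp⟩
    | succ k ih =>
      obtain ⟨m, hm⟩ := ih
      refine ⟨j * m, ?_⟩
      have h3 : ∀ l : ℕ, τ * ζ ^ l = (ζ ^ j) ^ l * τ := by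
        intro l
        induction l with
        | zero => simp
        | succ l ihl => rw [pow_succ, ← mul_assoc, ihl, mul_assoc, hj, ← mul_assoc, ← pow_succ]
      rw [pow_succ', mul_assoc, hm, ← mul_assoc, h3, mul_assoc, pow_mul]
  obtain ⟨m, hm⟩ := h2 n
  rw [hm, mul_inv_cancel_right₀ hτn] at h1
  have h3 : ζ ^ m = ζ := eq_of_pow_eq_of_sub_mem hQ (pow_mem_M_zero hζ0 m) hζ0
    ((Commute.refl ζ).pow_left m) (by rw [← pow_mul, mul_comm, pow_mul, hζQ]) hζQ h1
  rw [h3] at hm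
  obtain ⟨a, ha⟩ := exists_eq_algebraMap_of_commute hτ hgen (η := τ ^ n) hm
    ((Commute.refl τ).pow_left n)
  exact dvd_of_v_algebraMap_eq (S := S) (a := a) (by rw [← ha, v_pow_uniformizer hτ])

omit hϖ in
theorem algebraMap_conj {a : F} (ha : algebraMap F D a ≠ 0) (x : D) :
    algebraMap F D a * x * (algebraMap F D a)⁻¹ = x := by
  rw [Algebra.commutes, mul_inv_cancel_right₀ ha]

/-- `ϖ ^ n` has the valuation of a central element, and residual conjugation depends only on the
valuation. -/
theorem conj_pow_sub_mem {n : ℕ} (hn : d ∣ n) (hx : x ∈ S.M 0) :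
    ϖ ^ n * x * (ϖ ^ n)⁻¹ - x ∈ S.M 1 := by
  obtain ⟨m, rfl⟩ := hn
  obtain ⟨a, _, ha⟩ := S.exists_algebraMap_v_eq m
  have h := conj_sub_conj_mem (pow_ne_zero (d * m) (uniformizer_ne_zero hϖ))
    ((v_pow_uniformizer hϖ (d * m)).trans ha.symm) hx
  rwa [algebraMap_conj (ne_zero_of_v_eq ha)] at h

/-- A residue class fixed by `σ` has a Teichmüller representative `ζ ^ i` commuting with `τ` and
with `ζ`, hence central. -/
theorem exists_algebraMap_sub_mem_of_conj [Algebra.IsCentral F D] (hx : x ∈ S.M 0)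
    (h : ϖ * x * ϖ⁻¹ - x ∈ S.M 1) : ∃ a : F, x - algebraMap F D a ∈ S.M 1 := by
  obtain ⟨Q, hQ, ζ, τ, hζ1, hζQ, hτ, hgen, j, hj⟩ := exists_normalized_generators hϖ
  have hζ0 := mem_M_zero_of_unit hζ1
  have hτ0 := uniformizer_ne_zero hτ
  rcases hgen x hx with hx1 | ⟨i, hi⟩
  · exact ⟨0, by simpa using hx1⟩
  have hζi := pow_mem_M_zero hζ0 i
  have h1 := add_mem (conj_sub_conj_mem hτ0 (hτ.trans hϖ.symm) hx) h
  rw [sub_add_sub_cancel] at h1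
  have h2 : τ * ζ ^ i * τ⁻¹ - ζ ^ i ∈ S.M 1 := by
    have h3 := sub_mem (add_mem h1 hi) (M_conj hτ0 hi)
    have h4 : τ * x * τ⁻¹ - x + (x - ζ ^ i) - τ * (x - ζ ^ i) * τ⁻¹ = τ * ζ ^ i * τ⁻¹ - ζ ^ i := by
      rw [mul_sub, sub_mul]; abel
    rwa [h4] at h3
  have h3 : ∀ l : ℕ, τ * ζ ^ l = ζ ^ (j * l) * τ := by
    intro l
    induction l with
    | zero => simp
    | succ l ihl =>
      rw [pow_succ, ← mul_assoc, ihl, mul_assoc, hj, ← mul_assoc, ← pow_add, mul_add, mul_one]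
  rw [h3, mul_inv_cancel_right₀ hτ0] at h2
  have hQi : ∀ k : ℕ, (ζ ^ k) ^ Q = ζ ^ k := fun k => by rw [← pow_mul, mul_comm, pow_mul, hζQ]
  have h4 := eq_of_pow_eq_of_sub_mem hQ (pow_mem_M_zero hζ0 (j * i)) hζi
    (((Commute.refl ζ).pow_pow _ _)) (hQi _) (hQi _) h2
  have h5 := h3 i
  rw [h4] at h5
  obtain ⟨a, ha⟩ := exists_eq_algebraMap_of_commute hτ hgen (η := ζ ^ i)
    ((Commute.refl ζ).pow_left i) h5.symm
  exact ⟨a, by rwa [← ha]⟩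

end ValuedDivisionAlgebra

/-! ### Principal units, leading terms and reduced norms -/

namespace ValuedDivisionAlgebra

variable {F D : Type*} [Field F] [DivisionRing D] [Algebra F D] {p d : ℕ}
  {S : ValuedDivisionAlgebra F D p d} {i j n : ℕ}

variable (S) in
/-- The units congruent to `1` modulo the `i`-th power of the maximal ideal. -/
def U (i : ℕ) : Set Dˣ := {u | (u : D) - 1 ∈ S.M i}

variable (S) in
/-- The elements of `U i` of reduced norm `1`. -/
def U₁ (i : ℕ) : Set Dˣ := {u | u ∈ S.U i ∧ S.N (u : D) = 1}

theorem U_mono (h : i ≤ j) : S.U j ⊆ S.U i := fun _ hu => M_mono h hu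

theorem v_of_mem_U {u : Dˣ} (hi : 1 ≤ i) (hu : u ∈ S.U i) : S.v (u : D) = 1 :=
  v_eq_one_of_sub_mem (map_one _) (M_mono hi hu)

theorem mem_M_of_mem_U {u : Dˣ} (hi : 1 ≤ i) (hu : u ∈ S.U i) : (u : D) ∈ S.M 0 :=
  mem_M_zero_of_unit (v_of_mem_U hi hu)

theorem inv_mem_M_of_mem_U {u : Dˣ} (hi : 1 ≤ i) (hu : u ∈ S.U i) : ((u⁻¹ : Dˣ) : D) ∈ S.M 0 := by
  rw [Units.val_inv_eq_inv_val]
  exact inv_mem_M_zero (v_of_mem_U hi hu)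

theorem mul_mem_U {u u' : Dˣ} (hi : 1 ≤ i) (hu : u ∈ S.U i) (hu' : u' ∈ S.U i) :
    u * u' ∈ S.U i := by
  have h : ((u * u' : Dˣ) : D) - 1 = u * (u' - 1) + (u - 1) := by
    rw [Units.val_mul, mul_sub, mul_one]; abel
  change _ ∈ S.M i
  rw [h]
  exact add_mem (mul_mem_M_left (mem_M_of_mem_U hi hu) hu') hu

theorem inv_mem_U {u : Dˣ} (hi : 1 ≤ i) (hu : u ∈ S.U i) : u⁻¹ ∈ S.U i := by
  have h : ((u⁻¹ : Dˣ) : D) - 1 = -((u⁻¹ : Dˣ) * (u - 1)) := by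
    rw [mul_sub, Units.inv_mul, mul_one]; abel
  change _ ∈ S.M i
  rw [h]
  exact neg_mem (mul_mem_M_left (inv_mem_M_of_mem_U hi hu) hu)

theorem inv_mul_mem_U {c u : Dˣ} (hi : 1 ≤ i) (hc : c ∈ S.U i) (h : (u : D) - c ∈ S.M j) :
    c⁻¹ * u ∈ S.U j := by
  have h1 : ((c⁻¹ * u : Dˣ) : D) - 1 = (c⁻¹ : Dˣ) * ((u : D) - c) := by
    rw [mul_sub, Units.inv_mul, Units.val_mul]
  change _ ∈ S.M j
  rw [h1]
  exact mul_mem_M_left (inv_mem_M_of_mem_U hi hc) h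

variable (S) in
theorem exists_unit_one_add {y : D} (hi : 1 ≤ i) (hy : y ∈ S.M i) :
    ∃ u : Dˣ, (u : D) = 1 + y ∧ u ∈ S.U i := by
  have h : S.v (1 + y) = 1 :=
    v_eq_one_of_sub_mem (map_one _) (by rw [add_sub_cancel_left]; exact M_mono hi hy)
  refine ⟨Units.mk0 (1 + y) (ne_zero_of_unit h), rfl, ?_⟩
  change 1 + y - 1 ∈ S.M i
  rwa [add_sub_cancel_left]

theorem N_commutator (x y : Dˣ) : S.N ((x * y * x⁻¹ * y⁻¹ : Dˣ) : D) = 1 := by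
  have h : ((Units.map S.N) (x * y * x⁻¹ * y⁻¹) : Fˣ) = 1 := by
    rw [map_mul, map_mul, map_mul, map_inv, map_inv]
    rw [mul_right_comm (Units.map S.N x), mul_inv_cancel, one_mul, mul_inv_cancel]
  exact congrArg Units.val h

/-- The leading term of a commutator. -/
theorem commutator_sub_mem {x y : Dˣ} {α β : D} (hi : 1 ≤ i) (hj : 1 ≤ j) (hα : α ∈ S.M i)
    (hβ : β ∈ S.M j) (hx : (x : D) - 1 - α ∈ S.M (i + 1)) (hy : (y : D) - 1 - β ∈ S.M (j + 1)) :
    ((x * y * x⁻¹ * y⁻¹ : Dˣ) : D) - 1 - (α * β - β * α) ∈ S.M (i + j + 1) := by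
  have hx' : x ∈ S.U i := by
    have := add_mem (M_mono (Nat.le_succ i) hx) hα
    rwa [sub_add_cancel] at this
  have hy' : y ∈ S.U j := by
    have := add_mem (M_mono (Nat.le_succ j) hy) hβ
    rwa [sub_add_cancel] at this
  set a := (x : D) - 1 with ha
  set b := (y : D) - 1 with hb
  have h1 : a * b - b * a - (α * β - β * α) ∈ S.M (i + j + 1) := by
    have h2 : a * b - b * a - (α * β - β * α) =
        (a - α) * b + α * (b - β) - ((b - β) * a + β * (a - α)) := by noncomm_ring
    rw [h2]
    refine sub_mem (add_mem ?_ ?_) (add_mem ?_ ?_)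
    · have := mul_mem_M hx hy'; rwa [add_right_comm] at this
    · have := mul_mem_M hα hy; rwa [← add_assoc] at this
    · have := mul_mem_M hy hx'; rwa [add_right_comm, add_comm j i] at this
    · have := mul_mem_M hβ hx; rwa [← add_assoc, add_comm j i] at this
  have hxy : (y * x)⁻¹ ∈ S.U 1 := inv_mem_U le_rfl
    (mul_mem_U le_rfl (U_mono hj hy') (U_mono hi hx'))
  -- The identity `x y x⁻¹ y⁻¹ - 1 = (x y - y x) (y x)⁻¹`, where `x y - y x = a b - b a` and the
  -- last factor is a principal unit.
  have h3 : ((x * y * x⁻¹ * y⁻¹ : Dˣ) : D) - 1 =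
      (a * b - b * a) * (((y * x)⁻¹ : Dˣ) : D) := by
    have h4 : a * b - b * a = (x : D) * y - y * x := by rw [ha, hb]; noncomm_ring
    have h5 : x * y * x⁻¹ * y⁻¹ = x * y * (y * x)⁻¹ := by rw [mul_inv_rev, mul_assoc (x * y)]
    rw [h4, sub_mul, ← Units.val_mul, ← Units.val_mul, ← Units.val_mul, ← Units.val_mul,
      mul_inv_cancel, Units.val_one, h5]
  have hab : a * b - b * a ∈ S.M (i + j) := by
    refine sub_mem (mul_mem_M hx' hy') ?_
    rw [add_comm i j]
    exact mul_mem_M hy' hx'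
  have h5 : ((x * y * x⁻¹ * y⁻¹ : Dˣ) : D) - 1 - (α * β - β * α) =
      (a * b - b * a) * ((((y * x)⁻¹ : Dˣ) : D) - 1) + (a * b - b * a - (α * β - β * α)) := by
    rw [h3]; noncomm_ring
  rw [h5]
  exact add_mem (mul_mem_M hab hxy) h1

theorem mul_inv_sub_mem {x y : Dˣ} {α β : D} (hi : 1 ≤ i) (hα : α ∈ S.M i)
    (hβ : β ∈ S.M i) (hx : (x : D) - 1 - α ∈ S.M (i + 1)) (hy : (y : D) - 1 - β ∈ S.M (i + 1)) :
    ((x * y⁻¹ : Dˣ) : D) - 1 - (α - β) ∈ S.M (i + 1) := by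
  have hy' : y⁻¹ ∈ S.U i := inv_mem_U hi (by
    have := add_mem (M_mono (Nat.le_succ i) hy) hβ
    rwa [sub_add_cancel] at this)
  have h : ((x * y⁻¹ : Dˣ) : D) - 1 - (α - β) =
      ((x : D) - 1 - α - (y - 1 - β)) * (y⁻¹ : Dˣ) + (α - β) * ((y⁻¹ : Dˣ) - 1) := by
    have h1 : (x : D) - 1 - α - (y - 1 - β) = x - y - (α - β) := by abel
    rw [h1, sub_mul, sub_mul, Units.mul_inv, Units.val_mul, mul_sub, mul_one]
    abel
  rw [h]
  refine add_mem (mul_mem_M_right (sub_mem hx hy) (mem_M_of_mem_U hi hy')) ?_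
  exact M_mono (by omega) (mul_mem_M (sub_mem hα hβ) hy')

theorem v_algebraMap_sub_one (r : F) : S.v (algebraMap F D r - 1) = S.w (r - 1) ^ d := by
  rw [← v_algebraMap, map_sub (algebraMap F D), map_one]

theorem w_natCast_degree : S.w (d : F) = 1 :=
  (S.w_natCast_le_one d).antisymm (not_lt.1 fun h =>
    (S.prime.coprime_iff_not_dvd.1 S.coprime) ((S.w_natCast_lt_one_iff d).1 h))

theorem w_N_sub_one_pow_le {u : Dˣ} (hu : u ∈ S.U i) :
    S.w (S.N (u : D) - 1) ^ d ≤ WithZero.exp (-(i : ℤ)) := by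
  have h1 := S.N_one_add ((u : D) - 1) (mem_M_zero.1 (M_mono (Nat.zero_le i) hu))
  rw [add_sub_cancel] at h1
  exact h1.trans hu

theorem w_N_sub_one_lt {u : Dˣ} (hi : 1 ≤ i) (hu : u ∈ S.U i) : S.w (S.N (u : D) - 1) < 1 := by
  by_contra! h
  have h1 := (one_le_pow_of_one_le' h d).trans (w_N_sub_one_pow_le hu)
  rw [← WithZero.exp_zero, WithZero.exp_le_exp] at h1
  omega

/-- A principal unit has the same norm as a central principal unit of the same depth. -/
theorem exists_root_N {u : Dˣ} (hi : 1 ≤ i) (hu : u ∈ S.U i) :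
    ∃ r : F, r ^ d = S.N (u : D) ∧ S.w (r - 1) < 1 ∧ algebraMap F D r - 1 ∈ S.M i := by
  have h2 := w_N_sub_one_lt hi hu
  obtain ⟨r, hr, hr1⟩ := S.exists_root _ h2
  refine ⟨r, hr, hr1, ?_⟩
  rw [mem_M, v_algebraMap_sub_one, ← S.w.map_pow_sub_one_of_lt w_natCast_degree hr1, hr]
  exact w_N_sub_one_pow_le hu

/-- Central elements have valuation divisible by `d`, so they have no leading terms in other
degrees. -/
theorem mem_M_succ_of_not_dvd (hi : ¬ d ∣ i) {a : F} (h : algebraMap F D a ∈ S.M i) :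
    algebraMap F D a ∈ S.M (i + 1) :=
  mem_M_succ.2 (lt_of_le_of_ne h fun h' => hi (dvd_of_v_algebraMap_eq h'))

/-- In degrees not divisible by `d`, every leading term is that of an element of norm `1`. -/
theorem exists_normOne_lift {α : D} (hi : 1 ≤ i) (hd : ¬ d ∣ i) (hα : α ∈ S.M i) :
    ∃ u ∈ S.U₁ i, (u : D) - 1 - α ∈ S.M (i + 1) := by
  obtain ⟨u, hu, huU⟩ := S.exists_unit_one_add hi hα
  obtain ⟨r, hr, hr1, hrM⟩ := exists_root_N hi huU
  rw [← map_one (algebraMap F D), ← map_sub] at hrM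
  have hrM' := mem_M_succ_of_not_dvd hd hrM
  rw [map_sub, map_one] at hrM'
  have hr0 : algebraMap F D r ≠ 0 :=
    ne_zero_of_unit (v_eq_one_of_sub_mem (S := S) (map_one _) (M_mono (by omega) hrM'))
  -- Division by the central unit `c` of the same reduced norm makes the norm `1`; as `d ∤ i`, `c`
  -- lies one step deeper and leaves the leading term alone.
  set c : Dˣ := Units.mk0 (algebraMap F D r) hr0 with hc
  have hcU : c ∈ S.U (i + 1) := hrM'
  have hcU' := inv_mem_U (Nat.le_add_left 1 i) hcU
  have h1 : u * c⁻¹ ∈ S.U i := mul_mem_U hi huU (U_mono (Nat.le_succ i) hcU')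
  refine ⟨u * c⁻¹, ⟨h1, ?_⟩, ?_⟩
  · have h2 : S.N (c : D) = S.N (u : D) := by rw [← hr, hc, Units.val_mk0, S.N_algebraMap]
    have h3 : Units.map S.N (u * c⁻¹) = 1 := by
      rw [map_mul, map_inv, mul_inv_eq_one]
      exact Units.ext h2.symm
    exact congrArg Units.val h3
  · have h2 : ((u * c⁻¹ : Dˣ) : D) - 1 - α = u * ((c⁻¹ : Dˣ) - 1) := by
      rw [mul_sub, mul_one, Units.val_mul, sub_sub, hu]
    rw [h2]
    exact mul_mem_M_left (mem_M_of_mem_U hi huU) hcU'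

end ValuedDivisionAlgebra

/-! ### Commutators of norm-one principal units, degree by degree -/

namespace ValuedDivisionAlgebra

variable {F D : Type*} [Field F] [DivisionRing D] [Algebra F D] {p d : ℕ}
  {S : ValuedDivisionAlgebra F D p d} {i j n : ℕ}

variable (S) in
/-- The abstract commutator subgroup of the group of principal units of norm `1`. -/
def C : Subgroup Dˣ := Subgroup.closure (commutators (S.U₁ 1))

theorem N_eq_one_of_mem_C {c : Dˣ} (hc : c ∈ S.C) : S.N (c : D) = 1 := by
  have h : S.C ≤ (Units.map S.N).ker := by
    refine (Subgroup.closure_le _).2 ?_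
    rintro _ ⟨x, _, y, _, rfl⟩
    exact Units.ext (N_commutator x y)
  exact congrArg Units.val (h hc)

theorem commutator_mem_C {x y : Dˣ} (hi : 1 ≤ i) (hj : 1 ≤ j) (hx : x ∈ S.U₁ i) (hy : y ∈ S.U₁ j) :
    x * y * x⁻¹ * y⁻¹ ∈ S.C :=
  Subgroup.subset_closure ⟨x, ⟨U_mono hi hx.1, hx.2⟩, y, ⟨U_mono hj hy.1, hy.2⟩, rfl⟩

variable (S) in
include S in
theorem not_dvd_one : ¬ d ∣ 1 := fun h => by
  have := Nat.le_of_dvd one_pos h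
  have := S.one_lt
  omega

theorem natCast_degree_unit : S.v (d : D) = 1 := by
  rw [← map_natCast (algebraMap F D), v_algebraMap, w_natCast_degree, one_pow]

variable [Algebra.IsCentral F D] {ϖ : D} (hϖ : S.v ϖ = WithZero.exp (-1))

include hϖ

/-- With `γ' = β * ϖ`, the commutators of `(ϖ * t, β)` and `(ϖ, t * β)` have quotient with leading
term `t * γ' - γ' * t ≡ (t - σⁿ t) * γ'`. Since `σⁿ ≠ 1`, `t` can make the coefficient a unit, and
then `γ'` is solved for. All entries lift to norm one because `d` divides neither `1` nor `n - 1`.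
-/
theorem exists_mem_C_of_generic (hn : 2 ≤ n) (h1 : ¬ d ∣ n) (h2 : ¬ d ∣ n - 1) {γ : D}
    (hγ : γ ∈ S.M n) : ∃ c ∈ S.C, (c : D) - 1 - γ ∈ S.M (n + 1) := by
  obtain ⟨k, rfl⟩ : ∃ k, n = 1 + k := ⟨n - 1, by omega⟩
  rw [Nat.add_sub_cancel_left] at h2
  have hk : 1 ≤ k := by omega
  obtain ⟨t, ht, htn⟩ := exists_conj_pow_sub_notMem hϖ h1
  set t' := ϖ ^ (1 + k) * t * (ϖ ^ (1 + k))⁻¹ with ht'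
  have hϖ0 := uniformizer_ne_zero hϖ
  have hϖk : ϖ ^ (1 + k) ≠ 0 := pow_ne_zero _ hϖ0
  have ht'0 : t' ∈ S.M 0 := M_conj hϖk ht
  have hs : S.v (t - t') = 1 := by
    rw [Valuation.map_sub_swap]
    exact unit_of_mem_of_notMem (sub_mem ht'0 ht) htn
  set γ' := (t - t')⁻¹ * γ with hγ'
  have hγ'n : γ' ∈ S.M (1 + k) := mul_mem_M_left (inv_mem_M_zero hs) hγ
  set β := γ' * ϖ⁻¹ with hβ
  have hβk : β ∈ S.M k := by
    have := mul_inv_pow_mem hϖ (i := k) (j := 1) (by rwa [add_comm])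
    rwa [pow_one] at this
  have hβϖ : β * ϖ = γ' := by rw [hβ, inv_mul_cancel_right₀ hϖ0]
  have hϖ1 := uniformizer_mem hϖ
  have hϖt : ϖ * t ∈ S.M 1 := mul_mem_M_right hϖ1 ht
  have htβ : t * β ∈ S.M k := mul_mem_M_left ht hβk
  obtain ⟨x₁, hx₁, hx₁'⟩ := exists_normOne_lift le_rfl S.not_dvd_one hϖt
  obtain ⟨y₁, hy₁, hy₁'⟩ := exists_normOne_lift hk h2 hβk
  obtain ⟨x₂, hx₂, hx₂'⟩ := exists_normOne_lift le_rfl S.not_dvd_one hϖ1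
  obtain ⟨y₂, hy₂, hy₂'⟩ := exists_normOne_lift hk h2 htβ
  refine ⟨_, mul_mem (commutator_mem_C le_rfl hk hx₁ hy₁)
    (inv_mem (commutator_mem_C le_rfl hk hx₂ hy₂)), ?_⟩
  have hm : ∀ {a b : D}, a ∈ S.M 1 → b ∈ S.M k → a * b - b * a ∈ S.M (1 + k) := fun ha hb =>
    sub_mem (mul_mem_M ha hb) (by rw [add_comm]; exact mul_mem_M hb ha)
  have h3 := mul_inv_sub_mem (Nat.le_add_right 1 k) (hm hϖt hβk) (hm hϖ1 htβ)
    (commutator_sub_mem le_rfl hk hϖt hβk hx₁' hy₁') (commutator_sub_mem le_rfl hk hϖ1 htβ hx₂' hy₂')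
  have h4 : ϖ * t * β - β * (ϖ * t) - (ϖ * (t * β) - t * β * ϖ) = t * γ' - γ' * t := by
    rw [mul_assoc t, hβϖ, ← mul_assoc β, hβϖ, mul_assoc ϖ]
    abel
  rw [h4] at h3
  have h5 : γ' * t - t' * γ' ∈ S.M (1 + k + 1) := by
    have hg : γ' * (ϖ ^ (1 + k))⁻¹ ∈ S.M 0 := mul_inv_pow_mem hϖ (by rwa [zero_add])
    have h6 := mul_mem_M (mul_sub_mul_mem_M_one hg ht'0) (uniformizer_pow_mem hϖ (1 + k))
    have h7 : (γ' * (ϖ ^ (1 + k))⁻¹ * t' - t' * (γ' * (ϖ ^ (1 + k))⁻¹)) * ϖ ^ (1 + k) =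
        γ' * t - t' * γ' := by
      rw [sub_mul, mul_assoc t', inv_mul_cancel_right₀ hϖk, ht']
      congr 1
      simp only [mul_assoc, inv_mul_cancel₀ hϖk, mul_one]
      rw [inv_mul_cancel_left₀ hϖk]
    rwa [h7, add_comm 1] at h6
  have h8 : t * γ' - γ' * t - γ = -(γ' * t - t' * γ') := by
    have h9 : (t - t') * γ' = γ := by rw [hγ', mul_inv_cancel_left₀ (ne_zero_of_unit hs)]
    rw [← h9, sub_mul]
    abel
  have h10 := add_mem h3 (neg_mem h5)
  rw [← h8] at h10
  rwa [sub_add_sub_cancel] at h10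

/-- If `(σ - 1) ^ 2 = 0`, then `σ ^ k t = t + k δ` with `δ = σ t - t`; taking `k = d` gives `d δ =
0`, so `δ = 0` and `σ = 1`, a contradiction. This covers `d = 2` as well. -/
theorem exists_second_difference_notMem : ∃ c ∈ S.M 0,
    ϖ * (ϖ * c * ϖ⁻¹ - c) * ϖ⁻¹ - (ϖ * c * ϖ⁻¹ - c) ∉ S.M 1 := by
  by_contra! hall
  have hϖ0 := uniformizer_ne_zero hϖ
  obtain ⟨t, ht, htn⟩ := exists_conj_pow_sub_notMem hϖ S.not_dvd_one
  rw [pow_one] at htn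
  set δ := ϖ * t * ϖ⁻¹ - t with hδ
  have hδσ := hall t ht
  rw [← hδ] at hδσ
  clear_value δ
  have key : ∀ k : ℕ, ϖ ^ k * t * (ϖ ^ k)⁻¹ - t - k * δ ∈ S.M 1 := by
    intro k
    induction k with
    | zero => simp
    | succ k ih =>
      have h1 : ϖ ^ (k + 1) * t * (ϖ ^ (k + 1))⁻¹ - t - ((k + 1 : ℕ) : D) * δ =
          ϖ * (ϖ ^ k * t * (ϖ ^ k)⁻¹ - t - k * δ) * ϖ⁻¹ + k * (ϖ * δ * ϖ⁻¹ - δ) := by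
        have h2 : ϖ ^ (k + 1) * t * (ϖ ^ (k + 1))⁻¹ = ϖ * (ϖ ^ k * t * (ϖ ^ k)⁻¹) * ϖ⁻¹ := by
          rw [pow_succ', mul_inv_rev]; simp only [mul_assoc]
        have h3 : ϖ * (k * δ) * ϖ⁻¹ = k * (ϖ * δ * ϖ⁻¹) := by
          rw [← mul_assoc, ← Nat.cast_comm k ϖ]; simp only [mul_assoc]
        have h4 : ϖ * t * ϖ⁻¹ = δ + t := by rw [hδ, sub_add_cancel]
        rw [h2, mul_sub ϖ, mul_sub ϖ, sub_mul _ _ ϖ⁻¹, sub_mul _ _ ϖ⁻¹, h3, h4, mul_sub]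
        push_cast
        rw [add_mul, one_mul]
        abel
      rw [h1]
      exact add_mem (M_conj hϖ0 ih) (mul_mem_M_left (natCast_mem_M k) hδσ)
  have h5 := sub_mem (conj_pow_sub_mem hϖ (dvd_refl d) ht) (key d)
  rw [sub_sub_cancel] at h5
  have hd := natCast_degree_unit (S := S)
  have h6 := mul_mem_M_left (inv_mem_M_zero hd) h5
  rw [inv_mul_cancel_left₀ (ne_zero_of_unit hd)] at h6
  exact htn h6

/-- In degree `n - 1` a norm-one leading term is no longer arbitrary, but `b * π` with `b = σ c - c`
is one, being that of a commutator. Commuting with `a * ϖ` yields `a * (σ b - b) * ϖ * π`, and a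
unit second difference allows solving for `a`. -/
theorem exists_mem_C_of_dvd_pred (hn : 2 ≤ n) (h2 : d ∣ n - 1) {γ : D}
    (hγ : γ ∈ S.M n) : ∃ c ∈ S.C, (c : D) - 1 - γ ∈ S.M (n + 1) := by
  obtain ⟨m, hm⟩ := h2
  have hd := S.one_lt
  have hm1 : 1 ≤ m := by
    rcases Nat.eq_zero_or_pos m with rfl | h
    · omega
    · exact h
  have hdm : d ≤ d * m := Nat.le_mul_of_pos_right d hm1
  obtain ⟨a', _, ha'⟩ := S.exists_algebraMap_v_eq m
  rw [← hm] at ha'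
  set π := algebraMap F D a' with hπ
  have hπ0 : π ≠ 0 := ne_zero_of_v_eq ha'
  have hπM : π ∈ S.M (n - 1) := ha'.le
  have hπc : ∀ x : D, π * x = x * π := fun x => Algebra.commutes a' x
  have hϖ0 := uniformizer_ne_zero hϖ
  have hϖ1 := uniformizer_mem hϖ
  obtain ⟨c, hc, hcn⟩ := exists_second_difference_notMem hϖ
  set b := ϖ * c * ϖ⁻¹ - c with hb
  have hb0 : b ∈ S.M 0 := sub_mem (M_conj hϖ0 hc) hc
  set s := ϖ * b * ϖ⁻¹ - b with hs
  have hs1 : S.v s = 1 := unit_of_mem_of_notMem (sub_mem (M_conj hϖ0 hb0) hb0) hcn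
  clear_value s b
  -- an element of norm `1` with leading term `b * π`
  have hδ : c * ϖ⁻¹ * π ∈ S.M (n - 2) := by
    have h1 : c * π * (ϖ ^ 1)⁻¹ ∈ S.M (n - 2) := mul_inv_pow_mem hϖ (by
      rw [show n - 2 + 1 = n - 1 by omega]
      exact mul_mem_M_left hc hπM)
    rwa [pow_one, mul_assoc, hπc, ← mul_assoc] at h1
  obtain ⟨u, hu, huU⟩ := S.exists_unit_one_add le_rfl hϖ1
  obtain ⟨u', hu', huU'⟩ := S.exists_unit_one_add (by omega) hδ
  have hy := commutator_sub_mem (S := S) (x := u) (y := u') le_rfl (by omega) hϖ1 hδ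
    (by rw [hu, add_sub_cancel_left, sub_self]; exact zero_mem _)
    (by rw [hu', add_sub_cancel_left, sub_self]; exact zero_mem _)
  have hyN := N_commutator (S := S) u u'
  set y := u * u' * u⁻¹ * u'⁻¹
  have h1 : ϖ * (c * ϖ⁻¹ * π) - c * ϖ⁻¹ * π * ϖ = b * π := by
    rw [hb, sub_mul, mul_assoc (c * ϖ⁻¹), hπc ϖ, ← mul_assoc (c * ϖ⁻¹), inv_mul_cancel_right₀ hϖ0]
    simp only [mul_assoc]
  rw [h1, show 1 + (n - 2) + 1 = n - 1 + 1 by omega] at hy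
  have hβ : b * π ∈ S.M (n - 1) := mul_mem_M_left hb0 hπM
  have hy₁ : y ∈ S.U₁ (n - 1) := by
    refine ⟨?_, hyN⟩
    have := add_mem (M_mono (Nat.le_succ _) hy) hβ
    rwa [sub_add_cancel] at this
  -- the coefficient of the first entry
  set a := γ * π⁻¹ * ϖ⁻¹ * s⁻¹ with ha
  have ha0 : a ∈ S.M 0 := by
    refine mul_mem_M_right ?_ (inv_mem_M_zero hs1)
    rw [mem_M_zero, map_mul, map_mul, map_inv₀, map_inv₀, ha', hϖ, ← WithZero.exp_neg,
      ← WithZero.exp_neg, mul_assoc, ← WithZero.exp_add]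
    refine (mul_le_mul_left hγ _).trans_eq ?_
    rw [← WithZero.exp_add, ← WithZero.exp_zero]
    congr 1
    omega
  have hα : a * ϖ ∈ S.M 1 := mul_mem_M_left ha0 hϖ1
  obtain ⟨x, hx, hx'⟩ := exists_normOne_lift le_rfl S.not_dvd_one hα
  refine ⟨_, commutator_mem_C le_rfl (by omega) hx hy₁, ?_⟩
  have h3 := commutator_sub_mem le_rfl (by omega) hα hβ hx' hy
  rw [show 1 + (n - 1) + 1 = n + 1 by omega] at h3
  have h4 : a * ϖ * (b * π) - b * π * (a * ϖ) - γ = (a * b - b * a) * (ϖ * π) := by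
    have h5 : a * s * ϖ * π = γ := by
      rw [ha, inv_mul_cancel_right₀ (ne_zero_of_unit hs1), inv_mul_cancel_right₀ hϖ0,
        inv_mul_cancel_right₀ hπ0]
    have h6 : ϖ * b = s * ϖ + b * ϖ := by
      rw [hs, sub_mul, inv_mul_cancel_right₀ hϖ0, sub_add_cancel]
    have h7 : a * ϖ * (b * π) = a * s * ϖ * π + a * b * ϖ * π := by
      rw [← mul_assoc, mul_assoc a ϖ b, h6, mul_add, add_mul]
      simp only [mul_assoc]
    rw [h7, h5, mul_assoc b π, hπc (a * ϖ), sub_mul]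
    simp only [mul_assoc]
    abel
  have h5 : (a * b - b * a) * (ϖ * π) ∈ S.M (n + 1) := by
    have := mul_mem_M (mul_sub_mul_mem_M_one ha0 hb0) (mul_mem_M hϖ1 hπM)
    rwa [show 1 + (1 + (n - 1)) = n + 1 by omega] at this
  rw [← h4] at h5
  have := add_mem h3 h5
  rwa [sub_add_sub_cancel] at this

/-- Additive Hilbert 90 modulo the base field. -/
theorem exists_eq_add_conj_sub {g : D} (hg : g ∈ S.M 0) : ∃ (f : F) (h : D), h ∈ S.M 0 ∧
    g - (algebraMap F D f + (ϖ * h * ϖ⁻¹ - h)) ∈ S.M 1 := by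
  have hϖ0 := uniformizer_ne_zero hϖ
  -- `T k` is the partial trace of `g`; `T d` is `σ`-invariant modulo `M 1` and so comes from `F`.
  let T : ℕ → D := fun k => ∑ i ∈ Finset.range k, ϖ ^ i * g * (ϖ ^ i)⁻¹
  have hT0 : ∀ k, T k ∈ S.M 0 := fun k => sum_mem fun i _ => M_conj (pow_ne_zero i hϖ0) hg
  have hσT : ∀ k, ϖ * T k * ϖ⁻¹ - T k = ϖ ^ k * g * (ϖ ^ k)⁻¹ - g := by
    intro k
    have h1 : ϖ * T k * ϖ⁻¹ = ∑ i ∈ Finset.range k, ϖ ^ (i + 1) * g * (ϖ ^ (i + 1))⁻¹ := by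
      simp only [T]
      rw [Finset.mul_sum, Finset.sum_mul]
      refine Finset.sum_congr rfl fun i _ => ?_
      rw [pow_succ', mul_inv_rev]
      simp only [mul_assoc]
    have h2 := Finset.sum_range_succ (fun i => ϖ ^ i * g * (ϖ ^ i)⁻¹) k
    rw [Finset.sum_range_succ', ← h1] at h2
    simp only [pow_zero, one_mul, inv_one, mul_one] at h2
    change _ = T k + _ at h2
    rw [sub_eq_sub_iff_add_eq_add, h2, add_comm]
  -- Each `g - σ ^ k g` is a `σ - 1` image, so `k * g` is a partial trace plus such an image. For `k
  -- = d` one can then divide by the unit `d`.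
  have hk : ∀ k : ℕ, ∃ h ∈ S.M 0, (k : D) * g = T k + (ϖ * h * ϖ⁻¹ - h) := by
    intro k
    induction k with
    | zero => exact ⟨0, zero_mem _, by simp [T]⟩
    | succ k ih =>
      obtain ⟨h, hh, hk⟩ := ih
      refine ⟨h - T k, sub_mem hh (hT0 k), ?_⟩
      have h1 : T (k + 1) = T k + ϖ ^ k * g * (ϖ ^ k)⁻¹ := Finset.sum_range_succ _ k
      have h2 := hσT k
      rw [sub_eq_iff_eq_add] at h2
      push_cast
      rw [add_mul, one_mul, hk, h1, mul_sub, sub_mul, h2]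
      abel
  obtain ⟨h, hh, hdg⟩ := hk d
  have h1 : ϖ * T d * ϖ⁻¹ - T d ∈ S.M 1 := by
    rw [hσT]; exact conj_pow_sub_mem hϖ (dvd_refl d) hg
  obtain ⟨f, hf⟩ := exists_algebraMap_sub_mem_of_conj hϖ (hT0 d) h1
  have hd := natCast_degree_unit (S := S)
  have hd0 := ne_zero_of_unit hd
  have hcomm : ∀ x : D, (d : D)⁻¹ * x = x * (d : D)⁻¹ := fun x =>
    ((Nat.cast_commute d x).inv_left₀).eq
  refine ⟨(d : F)⁻¹ * f, (d : D)⁻¹ * h, mul_mem_M_left (inv_mem_M_zero hd) hh, ?_⟩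
  have h2 := mul_mem_M_left (inv_mem_M_zero hd) hf
  have h3 : g = (d : D)⁻¹ * (T d + (ϖ * h * ϖ⁻¹ - h)) := by
    rw [← hdg, inv_mul_cancel_left₀ hd0]
  have h4 : ϖ * ((d : D)⁻¹ * h) * ϖ⁻¹ = (d : D)⁻¹ * (ϖ * h * ϖ⁻¹) := by
    rw [← mul_assoc, ← hcomm ϖ]; simp only [mul_assoc]
  have h5 : g - (algebraMap F D ((d : F)⁻¹ * f) + (ϖ * ((d : D)⁻¹ * h) * ϖ⁻¹ - (d : D)⁻¹ * h)) =
      (d : D)⁻¹ * (T d - algebraMap F D f) := by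
    rw [h4, map_mul, map_inv₀, map_natCast]
    nth_rewrite 1 [h3]
    noncomm_ring
  rw [h5]
  exact h2

/-- Hilbert 90 gives the leading term as `(f + (σ h - h)) * π`; the commutator of `ϖ` and `h * ϖ⁻¹ *
π` removes the second part. The remaining `z` has norm `1` and is congruent to the central unit `1 +
f * a'`, so `(1 + f * a') ^ d` is as close to `1` as a norm from `U (n + 1)`; as `d` is a unit, so
is `1 + f * a'` itself. -/
theorem exists_mem_C_of_dvd (hn : 2 ≤ n) (h1 : d ∣ n) {u : Dˣ} (hu : u ∈ S.U₁ n) :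
    ∃ c ∈ S.C, c⁻¹ * u ∈ S.U₁ (n + 1) := by
  obtain ⟨m, hm⟩ := h1
  have hd := S.one_lt
  have hdn : ¬ d ∣ n - 1 := fun h => S.not_dvd_one (by
    have := Nat.dvd_sub (⟨m, hm⟩ : d ∣ n) h
    rwa [show n - (n - 1) = 1 by omega] at this)
  obtain ⟨a', _, ha'⟩ := S.exists_algebraMap_v_eq m
  rw [← hm] at ha'
  set π := algebraMap F D a' with hπ
  have hπ0 : π ≠ 0 := ne_zero_of_v_eq ha'
  have hπM : π ∈ S.M n := ha'.le
  have hπc : ∀ x : D, π * x = x * π := fun x => Algebra.commutes a' x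
  have hϖ0 := uniformizer_ne_zero hϖ
  have hϖ1 := uniformizer_mem hϖ
  have hg : ((u : D) - 1) * π⁻¹ ∈ S.M 0 := by
    rw [mem_M_zero, map_mul, map_inv₀, ha', ← WithZero.exp_neg]
    refine (mul_le_mul_left hu.1 _).trans_eq ?_
    rw [← WithZero.exp_add, ← WithZero.exp_zero]
    congr 1
    omega
  obtain ⟨f, h, hh, hfh⟩ := exists_eq_add_conj_sub hϖ hg
  have hβ : h * ϖ⁻¹ * π ∈ S.M (n - 1) := by
    have h1 : h * π * (ϖ ^ 1)⁻¹ ∈ S.M (n - 1) := mul_inv_pow_mem hϖ (by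
      rw [show n - 1 + 1 = n by omega]
      exact mul_mem_M_left hh hπM)
    rwa [pow_one, mul_assoc, hπc, ← mul_assoc] at h1
  obtain ⟨x, hx, hx'⟩ := exists_normOne_lift le_rfl S.not_dvd_one hϖ1
  obtain ⟨y, hy, hy'⟩ := exists_normOne_lift (by omega) hdn hβ
  have hcC := commutator_mem_C (S := S) le_rfl (by omega) hx hy
  have hc := commutator_sub_mem le_rfl (by omega) hϖ1 hβ hx' hy'
  set c := x * y * x⁻¹ * y⁻¹
  have h2 : ϖ * (h * ϖ⁻¹ * π) - h * ϖ⁻¹ * π * ϖ = (ϖ * h * ϖ⁻¹ - h) * π := by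
    rw [sub_mul, mul_assoc (h * ϖ⁻¹), hπc ϖ, ← mul_assoc (h * ϖ⁻¹), inv_mul_cancel_right₀ hϖ0]
    simp only [mul_assoc]
  rw [h2, show 1 + (n - 1) + 1 = n + 1 by omega] at hc
  have hcn : (ϖ * h * ϖ⁻¹ - h) * π ∈ S.M n :=
    mul_mem_M_left (sub_mem (M_conj hϖ0 hh) hh) hπM
  have hcU : c ∈ S.U n := by
    have := add_mem (M_mono (Nat.le_succ _) hc) hcn
    rwa [sub_add_cancel] at this
  have huc : (u : D) - c - algebraMap F D f * π ∈ S.M (n + 1) := by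
    have h3 := mul_mem_M hfh hπM
    rw [sub_mul, add_mul, inv_mul_cancel_right₀ hπ0, add_comm 1 n] at h3
    have h4 := sub_mem h3 hc
    have h5 : (u : D) - 1 - (algebraMap F D f * π + (ϖ * h * ϖ⁻¹ - h) * π) -
        (c - 1 - (ϖ * h * ϖ⁻¹ - h) * π) = u - c - algebraMap F D f * π := by abel
    rwa [h5] at h4
  have hucn : (u : D) - c ∈ S.M n := by
    have := sub_mem hu.1 (show (c : D) - 1 ∈ S.M n from hcU)
    rwa [sub_sub_sub_cancel_right] at this
  have hfπ : algebraMap F D f * π ∈ S.M n := by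
    have := sub_mem hucn (M_mono (Nat.le_succ _) huc)
    rwa [sub_sub_cancel] at this
  set z := c⁻¹ * u with hz
  have hzn : z ∈ S.U n := inv_mul_mem_U (by omega) hcU hucn
  have hcinv := inv_mem_U (by omega) hcU
  have hz1 : (z : D) - 1 - algebraMap F D f * π ∈ S.M (n + 1) := by
    have h3 : (z : D) - 1 - algebraMap F D f * π = (c⁻¹ : Dˣ) * ((u : D) - c - algebraMap F D f * π)
        + ((c⁻¹ : Dˣ) - 1) * (algebraMap F D f * π) := by
      have h4 : ((c⁻¹ : Dˣ) : D) * c = 1 := Units.inv_mul c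
      rw [hz, Units.val_mul, mul_sub, mul_sub, h4, sub_mul, one_mul]
      abel
    rw [h3]
    exact add_mem (mul_mem_M_left (inv_mem_M_of_mem_U (by omega) hcU) huc)
      (M_mono (by omega) (mul_mem_M hcinv hfπ))
  have hzN : S.N (z : D) = 1 := by
    have h3 : Units.map S.N z = 1 := by
      rw [hz, map_mul, map_inv, show Units.map S.N c = 1 from Units.ext (N_eq_one_of_mem_C hcC),
        show Units.map S.N u = 1 from Units.ext hu.2]
      simp
    exact congrArg Units.val h3
  -- compare norms
  obtain ⟨q, hq, hqU⟩ := S.exists_unit_one_add (by omega) hfπ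
  have hqF : (q : D) = algebraMap F D (1 + f * a') := by rw [hq, map_add, map_one, map_mul]
  have hqz : q⁻¹ * z ∈ S.U (n + 1) := inv_mul_mem_U (by omega) hqU (by
    rw [hq, ← sub_sub]; exact hz1)
  have hzq : z⁻¹ * q ∈ S.U (n + 1) := by
    have := inv_mem_U (by omega) hqz
    rwa [mul_inv_rev, inv_inv] at this
  have hN : S.N ((z⁻¹ * q : Dˣ) : D) = (1 + f * a') ^ d := by
    have h3 : S.N ((z⁻¹ : Dˣ) : D) = 1 := by
      have h4 := congrArg S.N (Units.inv_mul z)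
      rwa [map_mul, hzN, mul_one, map_one] at h4
    rw [Units.val_mul, map_mul, h3, one_mul, hqF, S.N_algebraMap]
  have hw := w_N_sub_one_pow_le hzq
  have hq1 : S.w (1 + f * a' - 1) < 1 := by
    by_contra! h3
    have h4 := one_le_pow_of_one_le' h3 d
    rw [← v_algebraMap_sub_one, ← hqF] at h4
    have h5 := h4.trans hqU
    rw [← WithZero.exp_zero, WithZero.exp_le_exp] at h5
    omega
  rw [hN, S.w.map_pow_sub_one_of_lt w_natCast_degree hq1, ← v_algebraMap_sub_one, ← hqF] at hw
  refine ⟨c, hcC, ?_, hzN⟩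
  have h3 := mul_mem_U (by omega) (show q ∈ S.U (n + 1) from hw) hqz
  rwa [mul_inv_cancel_left] at h3

/-- Successive approximation of norm one elements by commutators. -/
theorem exists_mem_C_inv_mul_mem (hn : 2 ≤ n) {u : Dˣ} (hu : u ∈ S.U₁ n) :
    ∃ c ∈ S.C, c⁻¹ * u ∈ S.U₁ (n + 1) := by
  by_cases h1 : d ∣ n
  · exact exists_mem_C_of_dvd hϖ hn h1 hu
  obtain ⟨c, hc, hcu⟩ : ∃ c ∈ S.C, (c : D) - 1 - ((u : D) - 1) ∈ S.M (n + 1) := by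
    by_cases h2 : d ∣ n - 1
    · exact exists_mem_C_of_dvd_pred hϖ hn h2 hu.1
    · exact exists_mem_C_of_generic hϖ hn h1 h2 hu.1
  rw [sub_sub_sub_cancel_right] at hcu
  have hcU : c ∈ S.U n := by
    have := add_mem (M_mono (Nat.le_succ n) hcu) hu.1
    rwa [sub_add_sub_cancel] at this
  refine ⟨c, hc, inv_mul_mem_U (by omega) hcU (by rw [← neg_sub]; exact neg_mem hcu), ?_⟩
  have h3 : Units.map S.N (c⁻¹ * u) = 1 := by
    rw [map_mul, map_inv, show Units.map S.N c = 1 from Units.ext (N_eq_one_of_mem_C hc),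
      show Units.map S.N u = 1 from Units.ext hu.2]
    simp
  exact congrArg Units.val h3

theorem exists_mem_C_inv_mul_mem_of_le {u : Dˣ} (hu : u ∈ S.U₁ 2) (n : ℕ) :
    ∃ c ∈ S.C, c⁻¹ * u ∈ S.U₁ (n + 2) := by
  induction n with
  | zero => exact ⟨1, one_mem _, by simpa using hu⟩
  | succ n ih =>
    obtain ⟨c, hc, hcu⟩ := ih
    obtain ⟨c', hc', hcu'⟩ := exists_mem_C_inv_mul_mem hϖ (by omega) hcu
    refine ⟨c * c', mul_mem hc hc', ?_⟩
    rw [mul_inv_rev, mul_assoc]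
    rwa [show n + 1 + 2 = n + 2 + 1 by omega]

end ValuedDivisionAlgebra

/-! ### The `p`-th powers of principal units -/

namespace ValuedDivisionAlgebra

variable {F D : Type*} [Field F] [DivisionRing D] [Algebra F D] {p d : ℕ}
  {S : ValuedDivisionAlgebra F D p d} {i j n : ℕ}

variable (S) in
include S in
theorem natCast_prime_mem : (p : D) ∈ S.M 1 := by
  rw [mem_M_one, ← map_natCast (algebraMap F D), v_algebraMap]
  have := S.one_lt
  exact pow_lt_one' ((S.w_natCast_lt_one_iff p).2 dvd_rfl) (by omega)

theorem pow_mem_M {x : D} (hx : x ∈ S.M i) (n : ℕ) : x ^ n ∈ S.M (n * i) := by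
  induction n with
  | zero => simpa using one_mem_M
  | succ n ih =>
    rw [pow_succ, add_mul, one_mul]
    exact mul_mem_M ih hx

theorem pow_mem_U_two {u : Dˣ} (hu : u ∈ S.U 1) : u ^ p ∈ S.U 2 := by
  have h := pow_sub_pow_mem_succ S.natCast_prime_mem (mem_M_of_mem_U le_rfl hu)
    (one_mem_M (S := S)) (Commute.one_right _) le_rfl hu
  rw [one_pow] at h
  change ((u ^ p : Dˣ) : D) - 1 ∈ S.M 2
  rwa [Units.val_pow_eq_pow_val]

section PAdic

variable {e : ℕ} (he : S.w (p : F) = WithZero.exp (-(e : ℤ))) (hep : d * e + 1 < p)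

include he in
theorem v_natCast_prime : S.v (p : D) = WithZero.exp (-((d * e : ℕ) : ℤ)) := by
  rw [← map_natCast (algebraMap F D), v_algebraMap, he, ← WithZero.exp_nsmul]
  simp

include he hep

/-- The linear term dominates: `p * y` has depth at least `d * e + j`, while `p ≥ d * e + 2` pushes
`y ^ p` at least one step further. -/
theorem add_pow_sub_mem {x y : D} (hxy : Commute x y) (hx : x - 1 ∈ S.M 1) (hj : 1 ≤ j)
    (hy : y ∈ S.M j) : (x + y) ^ p - x ^ p - p * y ∈ S.M (d * e + j + 1) := by
  have hx0 : x ∈ S.M 0 := mem_M_zero_of_unit (v_eq_one_of_sub_mem (map_one _) hx)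
  have hy0 : y ∈ S.M 0 := M_mono (Nat.zero_le _) hy
  have hp2 : 2 ≤ p := S.prime.two_le
  set s : D := ∑ k ∈ Finset.Ioo 0 p, x ^ (k - 1) * y ^ (p - k - 1) * ((p.choose k / p : ℕ) : D)
    with hs
  have h1 : (x + y) ^ p = x ^ p + y ^ p + p * x * y * s := hxy.add_pow_prime_eq S.prime
  have hs1 : s - 1 ∈ S.M 1 := by
    -- The index `k = p - 1` is the only one without a factor `y`; its coefficient `p / p` is `1`,
    -- so `s ≡ x ^ (p - 2) ≡ 1`.
    have hmem : p - 1 ∈ Finset.Ioo 0 p := by rw [Finset.mem_Ioo]; omega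
    rw [hs, ← Finset.add_sum_erase _ _ hmem]
    have h2 : x ^ (p - 1 - 1) * y ^ (p - (p - 1) - 1) * ((p.choose (p - 1) / p : ℕ) : D)
        = x ^ (p - 1 - 1) := by
      rw [show p - (p - 1) - 1 = 0 by omega, Nat.choose_symm_of_eq_add (show p = p - 1 + 1 by omega),
        Nat.choose_one_right, Nat.div_self (by omega)]
      simp
    rw [h2, add_sub_right_comm]
    refine add_mem ?_ (sum_mem fun k hk => ?_)
    · have := pow_sub_pow_mem hx0 (one_mem_M (S := S)) hx (p - 1 - 1)
      rwa [one_pow] at this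
    · rw [Finset.mem_erase, Finset.mem_Ioo] at hk
      refine mul_mem_M_right (mul_mem_M_left (pow_mem_M_zero hx0 _) ?_) (natCast_mem_M _)
      obtain ⟨l, hl⟩ : ∃ l, p - k - 1 = l + 1 := ⟨p - k - 2, by omega⟩
      rw [hl, pow_succ]
      exact mul_mem_M_left (pow_mem_M_zero hy0 l) (M_mono hj hy)
  have hxys : x * y * s - y ∈ S.M (j + 1) := by
    have h3 : x * y * s - y = x * y * (s - 1) + (x - 1) * y := by noncomm_ring
    rw [h3]
    refine add_mem (mul_mem_M (mul_mem_M_left hx0 hy) hs1) ?_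
    rw [add_comm]
    exact mul_mem_M hx hy
  have h4 : (x + y) ^ p - x ^ p - p * y = y ^ p + p * (x * y * s - y) := by
    rw [h1, mul_sub]
    simp only [mul_assoc]
    abel
  rw [h4]
  refine add_mem (M_mono ?_ (pow_mem_M hy p)) ?_
  · have : (d * e + 2) * j ≤ p * j := Nat.mul_le_mul_right j (by omega)
    have : d * e ≤ d * e * j := Nat.le_mul_of_pos_right _ hj
    nlinarith
  · rw [add_assoc]
    exact mul_mem_M (v_natCast_prime he).le hxys

theorem pow_mem_U_of_mem {u : Dˣ} (hu : u ∈ S.U 1) : u ^ p ∈ S.U (d * e + 1) := by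
  have h := add_pow_sub_mem he hep (Commute.one_left ((u : D) - 1))
    (by rw [sub_self]; exact zero_mem _) le_rfl hu
  rw [add_sub_cancel, one_pow] at h
  have h1 := add_mem (M_mono (Nat.le_succ _) h) (mul_mem_M (v_natCast_prime he).le hu)
  rw [sub_add_cancel] at h1
  change ((u ^ p : Dˣ) : D) - 1 ∈ S.M (d * e + 1)
  rwa [Units.val_pow_eq_pow_val]

theorem exists_pow_eq_of_mem_U {z : Dˣ} (hz : z ∈ S.U (d * e + 1)) : ∃ u ∈ S.U 1, u ^ p = z := by
  have hvp := v_natCast_prime he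
  have hp0 : (p : D) ≠ 0 := ne_zero_of_v_eq hvp
  have hdiv : ∀ {w : D} {i : ℕ}, w ∈ S.M (d * e + i) → (p : D)⁻¹ * w ∈ S.M i := by
    intro w i hw
    rw [mem_M, map_mul, map_inv₀, hvp, ← WithZero.exp_neg]
    refine (mul_le_mul_right hw _).trans_eq ?_
    rw [← WithZero.exp_add]
    congr 1
    push_cast
    ring
  -- Newton's iteration for `x ^ p = z`, with derivative simplified to `p` since `x ≡ 1`. Every
  -- iterate commutes with `z`, so the binomial estimate applies.
  let f : D → D := fun x => x + (p : D)⁻¹ * (z - x ^ p)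
  let x : ℕ → D := fun k => f^[k] 1
  have hxs : ∀ k, x (k + 1) = x k + (p : D)⁻¹ * (z - x k ^ p) := fun k =>
    Function.iterate_succ_apply' f k 1
  have hinv : ∀ k, Commute (x k) z ∧ x k - 1 ∈ S.M 1 ∧ (z : D) - x k ^ p ∈ S.M (d * e + (k + 1)) := by
    intro k
    induction k with
    | zero =>
      refine ⟨Commute.one_left _, ?_, ?_⟩
      · simp [x]
      · have hz' : (z : D) - 1 ∈ S.M (d * e + 1) := hz
        simpa [x] using hz'
    | succ k ih =>
      obtain ⟨hc, h1, h2⟩ := ih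
      have hδ := hdiv h2
      have hcδ : Commute (x k) ((p : D)⁻¹ * (z - x k ^ p)) :=
        ((Nat.cast_commute p (x k)).symm.inv_right₀).mul_right
          (hc.sub_right ((Commute.refl _).pow_right p))
      rw [hxs]
      set δ := (p : D)⁻¹ * (z - x k ^ p) with hδe
      refine ⟨hc.add_left ?_, ?_, ?_⟩
      · exact ((Nat.cast_commute p (z : D)).inv_left₀).mul_left
          ((Commute.refl _).sub_left (hc.pow_left p))
      · rw [add_sub_right_comm]
        exact add_mem h1 (M_mono (by omega) hδ)
      · have h3 := add_pow_sub_mem he hep hcδ h1 (by omega) hδ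
        have h4 : (p : D) * δ = z - x k ^ p := by rw [hδe, mul_inv_cancel_left₀ hp0]
        rw [h4] at h3
        have h5 : (z : D) - (x k + δ) ^ p = -((x k + δ) ^ p - x k ^ p - (z - x k ^ p)) := by abel
        rw [h5]
        exact neg_mem (by rwa [add_assoc] at h3)
  obtain ⟨y, hy⟩ := S.complete x fun k => by
    rw [hxs, add_sub_cancel_left]
    exact M_mono (Nat.le_succ k) (hdiv (hinv k).2.2)
  change ∀ k, y - x k ∈ S.M k at hy
  have hy1 : y - 1 ∈ S.M 1 := by
    have := add_mem (hy 1) (hinv 1).2.1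
    rwa [sub_add_sub_cancel] at this
  have hv1 : S.v y = 1 := v_eq_one_of_sub_mem (map_one _) hy1
  refine ⟨Units.mk0 y (ne_zero_of_unit hv1), hy1, Units.ext ?_⟩
  rw [Units.val_pow_eq_pow_val, Units.val_mk0, ← sub_eq_zero]
  refine eq_zero_of_forall_mem (S := S) fun k => ?_
  have hxk : x k ∈ S.M 0 := mem_M_zero_of_unit (v_eq_one_of_sub_mem (map_one _) (hinv k).2.1)
  have h1 := pow_sub_pow_mem (mem_M_zero_of_unit hv1) hxk (hy k) p
  have h2 := sub_mem h1 (M_mono (by omega) (hinv k).2.2)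
  have h3 : y ^ p - x k ^ p - (z - x k ^ p) = y ^ p - z := by abel
  rwa [h3] at h2

end PAdic

/-! ### Closures, the commutator subgroup and the Frattini subgroup -/

section Topology

variable [TopologicalSpace D] [IsTopologicalRing D]
  (hN : ∀ s : Set D, s ∈ nhds (0 : D) ↔ ∃ k : ℕ, (S.M k : Set D) ⊆ s)

include hN

theorem mem_nhds_one_iff (s : Set D) : s ∈ nhds (1 : D) ↔ ∃ k : ℕ, ∀ x, x - 1 ∈ S.M k → x ∈ s := by
  have h : s ∈ nhds (1 : D) ↔ (fun x => x + 1) ⁻¹' s ∈ nhds (0 : D) := by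
    rw [← Filter.mem_map, show (fun x : D => x + 1) = Homeomorph.addRight (1 : D) from rfl,
      Homeomorph.map_nhds_eq]
    simp
  rw [h, hN]
  refine exists_congr fun k => ⟨fun h x hx => ?_, fun h x hx => h _ (by simpa using hx)⟩
  simpa using h hx

theorem U_mem_nhds (n : ℕ) : S.U n ∈ nhds (1 : Dˣ) := by
  have h : {x : D | x - 1 ∈ S.M n} ∈ nhds ((1 : Dˣ) : D) :=
    (mem_nhds_one_iff hN _).2 ⟨n, fun x hx => hx⟩
  exact Units.continuous_val.continuousAt.preimage_mem_nhds h

/-- The topology on units controls both `u` and `u⁻¹`, but `U n` is stable under inversion for `n ≥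
1`. -/
theorem exists_U_subset_of_mem_nhds {s : Set Dˣ} (hs : s ∈ nhds (1 : Dˣ)) :
    ∃ n : ℕ, 1 ≤ n ∧ S.U n ⊆ s := by
  rw [Units.isInducing_embedProduct.nhds_eq_comap, Filter.mem_comap] at hs
  obtain ⟨t, ht, hts⟩ := hs
  rw [map_one, Prod.one_eq_mk, nhds_prod_eq, Filter.mem_prod_iff] at ht
  obtain ⟨a, ha, b, hb, hab⟩ := ht
  have hb' : MulOpposite.op ⁻¹' b ∈ nhds (1 : D) :=
    MulOpposite.continuous_op.continuousAt.preimage_mem_nhds hb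
  obtain ⟨k, hk⟩ := (mem_nhds_one_iff hN _).1 ha
  obtain ⟨l, hl⟩ := (mem_nhds_one_iff hN _).1 hb'
  refine ⟨max 1 (max k l), le_max_left _ _, fun u hu => hts (hab ⟨hk _ ?_, hl _ ?_⟩)⟩
  · exact M_mono ((le_max_left _ _).trans (le_max_right _ _)) hu
  · exact M_mono ((le_max_right _ _).trans (le_max_right _ _)) (inv_mem_U (le_max_left _ _) hu)

theorem mem_closure_iff_forall_U (A : Set Dˣ) (u : Dˣ) :
    u ∈ closure A ↔ ∀ n : ℕ, ∃ a ∈ A, a⁻¹ * u ∈ S.U n := by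
  rw [mem_closure_iff_nhds]
  constructor
  · intro h n
    have hc : ContinuousAt (fun a : Dˣ => a⁻¹ * u) u := by fun_prop
    obtain ⟨a, ha, haA⟩ := h _ (hc.preimage_mem_nhds
      (by rw [inv_mul_cancel]; exact U_mem_nhds hN n))
    exact ⟨a, haA, ha⟩
  · intro h t ht
    have hc : ContinuousAt (fun a : Dˣ => u * a) 1 := by fun_prop
    obtain ⟨n, hn1, hn⟩ := exists_U_subset_of_mem_nhds hN
      (hc.preimage_mem_nhds (by rwa [mul_one]))
    obtain ⟨a, haA, ha⟩ := h n
    refine ⟨a, ?_, haA⟩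
    have h1 := hn (inv_mem_U hn1 ha)
    simpa using h1

/-- Commutators have norm `1` and depth at least `1 + 1`; both conditions survive closure because `U
2` is closed and the norm is continuous at `1`. -/
theorem closedCommutator_subset {A : Set Dˣ} (hA : A ⊆ S.U 1) : closedCommutator A ⊆ S.U₁ 2 := by
  have h1 : ∀ c ∈ Subgroup.closure (commutators A), c ∈ S.U₁ 2 := by
    intro c hc
    refine ⟨?_, ?_⟩
    · induction hc using Subgroup.closure_induction with
      | mem c hc =>
        obtain ⟨x, hx, y, hy, rfl⟩ := hc
        have h := commutator_sub_mem (S := S) le_rfl le_rfl (hA hx) (hA hy)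
          (by rw [sub_self]; exact zero_mem _) (by rw [sub_self]; exact zero_mem _)
        have h' := add_mem (M_mono (Nat.le_succ _) h)
          (sub_mem (mul_mem_M (hA hx) (hA hy)) (mul_mem_M (hA hy) (hA hx)))
        rwa [sub_add_cancel] at h'
      | one => change _ ∈ S.M 2; simp
      | mul a b _ _ ha hb => exact mul_mem_U one_le_two ha hb
      | inv a _ ha => exact inv_mem_U one_le_two ha
    · have h : Subgroup.closure (commutators A) ≤ (Units.map S.N).ker := by
        refine (Subgroup.closure_le _).2 ?_
        rintro _ ⟨x, _, y, _, rfl⟩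
        exact Units.ext (N_commutator x y)
      exact congrArg Units.val (h hc)
  intro u hu
  rw [closedCommutator, mem_closure_iff_forall_U hN] at hu
  constructor
  · obtain ⟨a, ha, hau⟩ := hu 2
    have := mul_mem_U one_le_two (h1 a ha).1 hau
    rwa [mul_inv_cancel_left] at this
  · have h2 : algebraMap F D (S.N (u : D) - 1) = 0 := by
      refine eq_zero_of_forall_mem (S := S) fun n => ?_
      obtain ⟨a, ha, hau⟩ := hu n
      have h3 : S.N ((a⁻¹ * u : Dˣ) : D) = S.N (u : D) := by
        have h4 : Units.map S.N (a⁻¹ * u) = Units.map S.N u := by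
          rw [map_mul, map_inv, show Units.map S.N a = 1 from Units.ext (h1 a ha).2]
          simp
        exact congrArg Units.val h4
      have h5 := w_N_sub_one_pow_le hau
      rw [h3] at h5
      rw [mem_M, v_algebraMap]
      exact h5
    rw [map_eq_zero, sub_eq_zero] at h2
    exact h2

variable [Algebra.IsCentral F D] {ϖ : D} (hϖ : S.v ϖ = WithZero.exp (-1))

include hϖ

theorem closedCommutator_U₁ : closedCommutator (S.U₁ 1) = S.U₁ 2 := by
  refine (closedCommutator_subset hN fun _ h => h.1).antisymm fun u hu => ?_
  rw [closedCommutator, mem_closure_iff_forall_U hN]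
  intro n
  obtain ⟨c, hc, hcu⟩ := exists_mem_C_inv_mul_mem_of_le hϖ hu n
  exact ⟨c, hc, U_mono (by omega) hcu.1⟩

omit [Algebra.IsCentral F D] hϖ hN [IsTopologicalRing D] in
theorem closedCommutator_mono {A B : Set Dˣ} (h : A ⊆ B) :
    closedCommutator A ⊆ closedCommutator B := by
  refine closure_mono (Subgroup.closure_mono ?_)
  rintro _ ⟨x, hx, y, hy, rfl⟩
  exact ⟨x, h hx, y, h hy, rfl⟩

/-- Squeezed between the commutators of norm-one elements, which already fill `U₁ 2`, and the
general upper bound. -/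
theorem closedCommutator_U : closedCommutator (S.U 1) = S.U₁ 2 := by
  refine (closedCommutator_subset hN subset_rfl).antisymm ?_
  rw [← closedCommutator_U₁ hN hϖ]
  exact closedCommutator_mono fun _ h => h.1

variable (hcl : ∀ u : F, (∀ m : ℕ, ∃ r : F, S.w (r - 1) < 1 ∧
    S.w (u - r ^ p) ≤ WithZero.exp (-(m : ℤ))) → ∃ r : F, S.w (r - 1) < 1 ∧ u = r ^ p)

include hcl

omit [Algebra.IsCentral F D] hϖ in
-- Elements of depth `2` whose norm is a `p`-th power of a principal unit form a group containing
-- the generators; `hcl`, the closedness of those `p`-th powers, carries this to the closure.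
theorem closedFrattini_subset : closedFrattini p (S.U 1) ⊆
    {u | u ∈ S.U 2 ∧ ∃ r : F, S.w (r - 1) < 1 ∧ S.N (u : D) = r ^ p} := by
  have hunit : ∀ r : F, S.w (r - 1) < 1 → S.w r = 1 := fun r hr => by
    rw [← map_one S.w] at hr ⊢
    exact Valuation.map_eq_of_sub_lt _ hr
  have h1 : ∀ c ∈ Subgroup.closure (commutators (S.U 1) ∪ powerSet p (S.U 1)),
      c ∈ S.U 2 ∧ ∃ r : F, S.w (r - 1) < 1 ∧ S.N (c : D) = r ^ p := by
    intro c hc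
    induction hc using Subgroup.closure_induction with
    | mem c hc =>
      rcases hc with hc | ⟨x, hx, rfl⟩
      · have h2 := closedCommutator_subset hN (subset_refl (S.U 1))
          (subset_closure (Subgroup.subset_closure hc))
        exact ⟨h2.1, 1, by simp, by rw [h2.2, one_pow]⟩
      · refine ⟨pow_mem_U_two hx, S.N (x : D), w_N_sub_one_lt le_rfl hx, ?_⟩
        simp
    | one => exact ⟨by change _ ∈ S.M 2; simp, 1, by simp, by simp⟩
    | mul a b _ _ ha hb =>
      obtain ⟨ha, r, hr, har⟩ := ha
      obtain ⟨hb, s, hs, hbs⟩ := hb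
      refine ⟨mul_mem_U one_le_two ha hb, r * s, ?_, by rw [Units.val_mul, map_mul, har, hbs, mul_pow]⟩
      have h2 : r * s - 1 = r * (s - 1) + (r - 1) := by ring
      rw [h2]
      refine S.w.map_add_lt ?_ hr
      rwa [map_mul, hunit r hr, one_mul]
    | inv a _ ha =>
      obtain ⟨ha, r, hr, har⟩ := ha
      have hr1 := hunit r hr
      have hr0 : r ≠ 0 := by
        rintro rfl
        simp at hr1
      refine ⟨inv_mem_U one_le_two ha, r⁻¹, ?_, ?_⟩
      · have h2 : r⁻¹ - 1 = -(r⁻¹ * (r - 1)) := by field_simp; ring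
        rw [h2, Valuation.map_neg, map_mul, map_inv₀, hr1, inv_one, one_mul]
        exact hr
      · have h2 := congrArg S.N (Units.inv_mul a)
        rw [map_mul, map_one, har] at h2
        rw [inv_pow]
        exact eq_inv_of_mul_eq_one_left h2
  intro u hu
  rw [closedFrattini, mem_closure_iff_forall_U hN] at hu
  constructor
  · obtain ⟨a, ha, hau⟩ := hu 2
    have := mul_mem_U one_le_two (h1 a ha).1 hau
    rwa [mul_inv_cancel_left] at this
  -- Depth `d * m` in `D` is needed for precision `m` in `F`, since the norm estimate controls only
  -- the `d`-th power.
  · refine hcl _ fun m => ?_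
    obtain ⟨a, ha, hau⟩ := hu (d * m)
    obtain ⟨_, r, hr, har⟩ := h1 a ha
    refine ⟨r, hr, ?_⟩
    have h2 : S.N (u : D) - r ^ p = r ^ p * (S.N ((a⁻¹ * u : Dˣ) : D) - 1) := by
      rw [mul_sub, mul_one, ← har, ← map_mul, ← Units.val_mul, mul_inv_cancel_left]
    rw [h2, map_mul, map_pow, hunit r hr, one_pow, one_mul]
    have h3 := w_N_sub_one_pow_le hau
    have hd : d ≠ 0 := by have := S.one_lt; omega
    rw [show WithZero.exp (-((d * m : ℕ) : ℤ)) = WithZero.exp (-(m : ℤ)) ^ d by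
      rw [← WithZero.exp_nsmul]; simp] at h3
    exact (pow_le_pow_iff_left₀ zero_le zero_le hd).1 h3

/-- If `N u = (s ^ d) ^ p`, the central unit `s` satisfies `N (s ^ p) = N u`, so `u * s ^ (-p)` has
norm `1` and stays in `U 2`. -/
theorem closedFrattini_eq_U₁_mul : closedFrattini p (S.U 1) = S.U₁ 2 * powerSet p (S.U 1) := by
  apply Set.Subset.antisymm
  · intro u hu
    obtain ⟨hu2, r, hr, hur⟩ := closedFrattini_subset hN hcl hu
    obtain ⟨s, rfl, hs⟩ := S.exists_root r hr
    have hs' : algebraMap F D s - 1 ∈ S.M 1 := by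
      rw [mem_M_one, v_algebraMap_sub_one]
      exact pow_lt_one' hs (by have := S.one_lt; omega)
    have hs0 : algebraMap F D s ≠ 0 :=
      ne_zero_of_unit (v_eq_one_of_sub_mem (S := S) (map_one _) hs')
    set c : Dˣ := Units.mk0 (algebraMap F D s) hs0 with hc
    have hcU : c ∈ S.U 1 := hs'
    refine Set.mem_mul.2 ⟨u * (c ^ p)⁻¹, ⟨?_, ?_⟩, c ^ p, ⟨c, hcU, rfl⟩, by simp⟩
    · exact mul_mem_U one_le_two hu2 (inv_mem_U one_le_two (pow_mem_U_two hcU))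
    · have h1 : Units.map S.N u = Units.map S.N (c ^ p) := by
        refine Units.ext ?_
        change S.N (u : D) = S.N ((c ^ p : Dˣ) : D)
        rw [hur, Units.val_pow_eq_pow_val, map_pow, hc, Units.val_mk0, S.N_algebraMap]
      have h2 : Units.map S.N (u * (c ^ p)⁻¹) = 1 := by
        rw [map_mul, map_inv, h1, mul_inv_cancel]
      exact congrArg Units.val h2
  · rintro _ ⟨x, hx, y, hy, rfl⟩
    have hmul : ∀ a ∈ closedFrattini p (S.U 1), ∀ b ∈ closedFrattini p (S.U 1),
        a * b ∈ closedFrattini p (S.U 1) := fun a ha b hb =>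
      (Subgroup.topologicalClosure
        (Subgroup.closure (commutators (S.U 1) ∪ powerSet p (S.U 1)))).mul_mem ha hb
    refine hmul x ?_ y (subset_closure (Subgroup.subset_closure (Or.inr hy)))
    rw [← closedCommutator_U hN hϖ] at hx
    exact closure_mono (Subgroup.closure_mono Set.subset_union_left) hx

theorem closedFrattini_eq_mul :
    closedFrattini p (S.U 1) = closedCommutator (S.U 1) * powerSet p (S.U 1) := by
  rw [closedCommutator_U hN hϖ, closedFrattini_eq_U₁_mul hN hϖ hcl]

/-- As `p`-th powers lie in `U 2`, a product lies in `U 2` exactly when its norm-one factor does. -/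
theorem closedFrattini_eq_inter :
    closedFrattini p (S.U 1) = (S.U₁ 1 * powerSet p (S.U 1)) ∩ S.U 2 := by
  rw [closedFrattini_eq_U₁_mul hN hϖ hcl]
  have hP : ∀ y ∈ powerSet p (S.U 1), y ∈ S.U 2 := by
    rintro _ ⟨x, hx, rfl⟩
    exact pow_mem_U_two hx
  apply Set.Subset.antisymm
  · rintro _ ⟨x, hx, y, hy, rfl⟩
    exact ⟨⟨x, ⟨U_mono one_le_two hx.1, hx.2⟩, y, hy, rfl⟩, mul_mem_U one_le_two hx.1 (hP y hy)⟩
  · rintro _ ⟨⟨x, hx, y, hy, rfl⟩, hxy⟩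
    refine ⟨x, ⟨?_, hx.2⟩, y, hy, rfl⟩
    have := mul_mem_U one_le_two hxy (inv_mem_U one_le_two (hP y hy))
    simpa using this

end Topology

end ValuedDivisionAlgebra

/-! ### Specialization to local fields and the main theorem -/

theorem localValuation_natCast_prime (F : Type*) [Field F] [ValuativeRel F] [TopologicalSpace F]
    [IsNonarchimedeanLocalField F] [CharZero F] (p : ℕ) [Fact p.Prime] [CharP 𝓀[F] p] :
    0 < absRamificationIndex F p ∧
      localValuation F (p : F) = WithZero.exp (-(absRamificationIndex F p : ℤ)) := by
  have h0 : localValuation F (p : F) ≠ 0 :=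
    (localValuation F).ne_zero_iff.2 (Nat.cast_ne_zero.2 (Fact.out : p.Prime).ne_zero)
  have h1 := (localValuation_natCast_lt_one_iff F p p).2 dvd_rfl
  have h2 : WithZero.log (localValuation F (p : F)) < 0 := by
    rwa [← WithZero.exp_lt_exp, WithZero.exp_log h0, WithZero.exp_zero]
  have h3 : (absRamificationIndex F p : ℤ) = -WithZero.log (localValuation F (p : F)) :=
    Int.toNat_of_nonneg (by change 0 ≤ -WithZero.log (localValuation F (p : F)); omega)
  refine ⟨by omega, ?_⟩
  rw [h3, neg_neg, WithZero.exp_log h0]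

theorem mainTheorem3
    (F : Type*) [Field F] [ValuativeRel F] [TopologicalSpace F] [IsNonarchimedeanLocalField F]
    (p : ℕ) [Fact p.Prime] [CharP 𝓀[F] p]
    (D : Type*) [DivisionRing D] [Algebra F D] [Algebra.IsCentral F D] [FiniteDimensional F D]
    [TopologicalSpace D] [IsModuleTopology F D]
    (d : ℕ) (hd : 1 < d) (hD : Module.finrank F D = d ^ 2)
    (ϖ : D) (hϖ : IsDivisionUniformizer F ϖ)
    (hp : (CharZero F ∧ d * absRamificationIndex F p + 1 < p) ∨ (CharP F p ∧ p.Coprime d)) :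
    -- the Frattini subgroup of `I_1` is the product `[I_1, I_1] I_1 ^ p`
    closedFrattini p (unitFiltration F ϖ 1)
        = closedCommutator (unitFiltration F ϖ 1) * powerSet p (unitFiltration F ϖ 1)
    -- and it equals `I_{1, Nrd = 1} I_1 ^ p ∩ I_2`
    ∧ closedFrattini p (unitFiltration F ϖ 1)
        = (unitFiltrationNormOne F ϖ 1 * powerSet p (unitFiltration F ϖ 1)) ∩ unitFiltration F ϖ 2
    -- the commutator subgroup of `I_{1, Nrd = 1}` is `I_{2, Nrd = 1}`
    ∧ closedCommutator (unitFiltrationNormOne F ϖ 1) = unitFiltrationNormOne F ϖ 2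
    -- `I_1 ^ p = 1 + ϖ ^ (d e + 1) O_D` in the `p`-adic case
    ∧ (CharZero F →
        (fun u : Dˣ => (u : D)) '' powerSet p (unitFiltration F ϖ 1)
          = onePlus F ϖ (d * absRamificationIndex F p + 1))
    -- `I_1 ^ p = 1 + (ϖ O_D) ^ p` in the function field case
    ∧ (CharP F p →
        (fun u : Dˣ => (u : D)) '' powerSet p (unitFiltration F ϖ 1)
          = {z | ∃ y ∈ divisionIntegers F, z = 1 + (ϖ * y) ^ p}) := by
  have hpp : p.Prime := Fact.out
  have hpd : p.Coprime d := by
    rcases hp with ⟨_, hlt⟩ | ⟨_, hpd⟩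
    · have he := (localValuation_natCast_prime F p).1
      have hle := Nat.le_mul_of_pos_right d he
      -- Since `e ≥ 1`, the bound `p > d * e + 1` exceeds `d`, so `p` cannot divide `d`.
      exact hpp.coprime_iff_not_dvd.2 fun h => absurd (Nat.le_of_dvd (by omega) h) (by omega)
    · exact hpd
  have hchar : CharZero F ∨ ∃ q : ℕ, CharP F q ∧ ¬ q ∣ Module.finrank F D := by
    refine hp.imp And.left fun h => ⟨p, h.1, fun hdvd => ?_⟩
    rw [hD] at hdvd
    exact (hpp.coprime_iff_not_dvd.1 hpd) (hpp.dvd_of_dvd_pow hdvd)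
  have hN0 : reducedNorm F ϖ ≠ 0 := fun h0 => by
    have h1 : localValuation F (reducedNorm F ϖ) = WithZero.exp (-1) := hϖ
    rw [h0, map_zero] at h1
    exact WithZero.exp_ne_zero h1.symm
  obtain ⟨n, ⟨φ⟩⟩ := exists_splitting_of_reducedNorm_ne_zero hN0
  obtain rfl : n = d :=
    Nat.pow_left_injective two_ne_zero ((sq_eq_finrank_of_splitting φ).trans hD)
  -- The splitting has size `d`, so the valuation of the reduced norm is normalized by `v ϖ = exp
  -- (-1)`, and the filtrations below become those of `S`.
  let S := localDivisionAlgebra φ hchar p hpd hd hϖ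
  have hϖ' : S.v ϖ = WithZero.exp (-1) := hϖ
  have : IsTopologicalRing D := IsModuleTopology.isTopologicalRing F D
  have hN : ∀ s, s ∈ nhds (0 : D) ↔ ∃ k, (S.M k : Set D) ⊆ s :=
    divisionValuation_mem_nhds_zero_iff φ hchar hϖ
  have hcl : ∀ u : F, (∀ m : ℕ, ∃ r : F, S.w (r - 1) < 1 ∧
      S.w (u - r ^ p) ≤ WithZero.exp (-(m : ℤ))) → ∃ r : F, S.w (r - 1) < 1 ∧ u = r ^ p :=
    exists_pow_eq_of_approx F p
  have hint : ∀ y : D, y ∈ divisionIntegers F ↔ y ∈ S.M 0 := fun y =>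
    (ValuedDivisionAlgebra.mem_M_zero (S := S) (x := y)).symm
  have hmem : ∀ (i : ℕ) (y : D), y ∈ S.M i ↔ ∃ x ∈ divisionIntegers F, y = ϖ ^ i * x := by
    intro i y
    have hne : ϖ ^ i ≠ 0 := pow_ne_zero _ (ValuedDivisionAlgebra.ne_zero_of_v_eq hϖ')
    constructor
    · intro hy
      refine ⟨(ϖ ^ i)⁻¹ * y, (hint _).2 ?_, (mul_inv_cancel_left₀ hne y).symm⟩
      exact ValuedDivisionAlgebra.inv_pow_mul_mem hϖ' (by rwa [zero_add])
    · rintro ⟨x, hx, rfl⟩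
      exact ValuedDivisionAlgebra.mul_mem_M_right (ValuedDivisionAlgebra.uniformizer_pow_mem hϖ' i)
        ((hint x).1 hx)
  have hone : ∀ (i : ℕ) (z : D), z ∈ onePlus F ϖ i ↔ z - 1 ∈ S.M i := by
    intro i z
    rw [hmem]
    simp only [onePlus, Set.mem_ofPred_eq, sub_eq_iff_eq_add']
  have hU : ∀ i, unitFiltration F ϖ i = S.U i := fun i => Set.ext fun u => hone i u
  have hU₁ : ∀ i, unitFiltrationNormOne F ϖ i = S.U₁ i := fun i => by
    ext u
    change u ∈ unitFiltration F ϖ i ∧ _ ↔ u ∈ S.U i ∧ _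
    rw [hU]
    rfl
  simp only [hU, hU₁]
  refine ⟨S.closedFrattini_eq_mul hN hϖ' hcl, S.closedFrattini_eq_inter hN hϖ' hcl,
    S.closedCommutator_U₁ hN hϖ', fun _ => ?_, fun _ => ?_⟩
  · have hlt : n * absRamificationIndex F p + 1 < p := by
      rcases hp with h | h
      · exact h.2
      · have := h.1
        exact absurd (CharP.cast_eq_zero F p) (Nat.cast_ne_zero.2 hpp.ne_zero)
    have he : S.w (p : F) = _ := (localValuation_natCast_prime F p).2
    ext z
    rw [hone]
    constructor
    · rintro ⟨_, ⟨u, hu, rfl⟩, rfl⟩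
      exact S.pow_mem_U_of_mem he hlt hu
    · intro hz
      obtain ⟨z', hz', hzU⟩ := S.exists_unit_one_add (Nat.le_add_left 1 _) hz
      obtain ⟨u, hu, hup⟩ := S.exists_pow_eq_of_mem_U he hlt hzU
      exact ⟨z', ⟨u, hu, hup⟩, by simpa using hz'⟩
  · have : CharP D p := charP_of_injective_algebraMap (algebraMap F D).injective p
    ext z
    constructor
    · rintro ⟨_, ⟨u, hu, rfl⟩, rfl⟩
      obtain ⟨y, hy, huy⟩ := (hmem 1 _).1 hu
      rw [pow_one, sub_eq_iff_eq_add'] at huy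
      refine ⟨y, hy, ?_⟩
      change ((u ^ p : Dˣ) : D) = _
      -- Freshman's dream, valid in the noncommutative `D` because `1` and `ϖ * y` commute.
      rw [Units.val_pow_eq_pow_val, huy, add_pow_char_of_commute _ (Commute.one_left _), one_pow]
    · rintro ⟨y, hy, rfl⟩
      obtain ⟨u, hu, huU⟩ := S.exists_unit_one_add le_rfl
        ((hmem 1 _).2 ⟨y, hy, congrArg (· * y) (pow_one ϖ).symm⟩)
      refine ⟨u ^ p, ⟨u, huU, rfl⟩, ?_⟩
      change ((u ^ p : Dˣ) : D) = _
      rw [Units.val_pow_eq_pow_val, hu, add_pow_char_of_commute _ (Commute.one_left _), one_pow]
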